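/- Consider structures $\mathbf U=\langle U;f,T,I\rangle$, where $f$ is a unary operation, $T\subseteq U^3$ and $I\subseteq U$. Let $\mathsf{FAS}$ be the class of all finite such structures satisfying (P) for all $a,b,c\in U$, if $(a,b,c)\in T$, then $(f(a),c,b)\in T$ and $(c,f(b),a)\in T$; (I) for all $a,b\in U$, we have $a=b$ if and only if $(a,i,b)\in T$ for some $i\in I$. A structure is called *integral* if $|I|=1$ and *symmetric* if $f(x)=x$ for all $x\in U$. Let $\mathsf{FSIAS}$ be the class of all symmetric and integral members of $\mathsf{FAS}$. For a class $\mathcal K$ of such structures that is finite-membered, closed under isomorphism and has no upper bound on the size of its members, let $\mathcal U_n$ be a set with exactly one representative from each isomorphism class of $n$-element members of $\mathcal K$, let $\mathcal L_n$ be the set of members of $\mathcal K$ with universe a fixed $n$-element set, and let $s$ be the increasing enumeration of the integers $n\ge 1$ with $\mathcal U_n\ne\varnothing$. For an isomorphism-invariant property $P$, the *unlabelled* (resp. *labelled*) *probability* of $P$ in $\mathcal K$ is the limit as $n\to\infty$ of the fraction of the members of $\mathcal U_{s(n)}$ (resp. $\mathcal L_{s(n)}$) that satisfy $P$, if this limit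 exists. *Almost all* members of $\mathcal K$ satisfy $P$ if the unlabelled probability of $P$ in $\mathcal K$ exists and equals $1$. **Theorem.** Almost all members of $\mathsf{FAS}$ belong to $\mathsf{FSIAS}$, and the labelled probability of belonging to $\mathsf{FSIAS}$ in $\mathsf{FAS}$ also exists and equals $1$. The same holds for the class of atom structures of finite nonassociative relation algebras: its members are almost all symmetric and integral, and the labelled probability of being symmetric and integral in this class also exists and equals $1$. Here a *nonassociative relation algebra* is a Boolean algebra with a binary operation $\cdot$, a unary operation $\breve{\ }$ and an element $e$ that is a two-sided identity for $\cdot$, such that for all $x,y,z$ $$xy\wedge z=0\iff \breve{x}z\wedge y=0\iff z\breve{y}\wedge x=0;$$ the *atom structure* of a finite such algebra is the set of its atoms with $f(a)=\breve a$, $I=\{a : a\le e\}$ and $T=\{(a,b,c) : ab\ge c\}$, and the class is taken to be closed under isomorphism. -/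

import Mathlib

open Filter Topology

namespace FiniteNA

/-! ### Structures of the signature `{f, T, I}` -/

/-- A `{f, T, I}`-structure with universe `U`: a unary operation, a ternary relation and a
unary relation. -/
@[ext]
structure Str (U : Type*) where
  f : U → U
  T : Set (U × U × U)
  I : Set U

/-- `σ` is an isomorphism from `S` to `S'`. -/
def IsIso {U V : Type*} (S : Str U) (S' : Str V) (σ : U ≃ V) : Prop :=
  (∀ a, σ (S.f a) = S'.f (σ a)) ∧
  (∀ a b c, (a, b, c) ∈ S.T ↔ (σ a, σ b, σ c) ∈ S'.T) ∧
  (∀ a, a ∈ S.I ↔ σ a ∈ S'.I)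

/-- Two structures are isomorphic. -/
def Isomorphic {U V : Type*} (S : Str U) (S' : Str V) : Prop :=
  ∃ σ : U ≃ V, IsIso S S' σ

/-- Isomorphism of structures with a common universe, as an equivalence relation. -/
def isoSetoid (U : Type*) : Setoid (Str U) where
  r := Isomorphic
  iseqv := by
    refine ⟨fun S => ⟨Equiv.refl U, by simp [IsIso]⟩, ?_, ?_⟩
    · rintro S S' ⟨σ, h1, h2, h3⟩
      refine ⟨σ.symm, fun a => ?_, fun a b c => ?_, fun a => ?_⟩
      · rw [Equiv.symm_apply_eq, h1, Equiv.apply_symm_apply]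
      · simp [h2]
      · simp [h3]
    · rintro S S' S'' ⟨σ, h1, h2, h3⟩ ⟨τ, k1, k2, k3⟩
      refine ⟨σ.trans τ, fun a => ?_, fun a b c => ?_, fun a => ?_⟩
      · simp [h1, k1]
      · simp [h2, k2]
      · simp [h3, k3]

/-- A class (or a property) of `{f, T, I}`-structures. -/
abbrev StrClass := ∀ U : Type, Str U → Prop

/-! ### The classes `FAS` and `FSIAS` -/

/-- For all `a, b, c`, if `(a, b, c) ∈ T` then `(f a, c, b) ∈ T` and `(c, f b, a) ∈ T`. -/
def AxP {U : Type*} (S : Str U) : Prop :=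
  ∀ a b c, (a, b, c) ∈ S.T → (S.f a, c, b) ∈ S.T ∧ (c, S.f b, a) ∈ S.T

/-- For all `a, b`, we have `a = b` iff `(a, i, b) ∈ T` for some `i ∈ I`. -/
def AxI {U : Type*} (S : Str U) : Prop :=
  ∀ a b, a = b ↔ ∃ i ∈ S.I, (a, i, b) ∈ S.T

def IsIntegral {U : Type*} (S : Str U) : Prop := S.I.ncard = 1

def IsSymmetric {U : Type*} (S : Str U) : Prop := ∀ a, S.f a = a

def FAS : StrClass := fun U S => Finite U ∧ AxP S ∧ AxI S

def FSIAS : StrClass := fun U S => FAS U S ∧ IsSymmetric S ∧ IsIntegral S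

/-! ### Labelled and unlabelled probabilities -/

/-- The structures in `K` with the fixed `n`-element universe `Fin n`. -/
def labelled (K : StrClass) (n : ℕ) : Set (Str (Fin n)) := {S | K (Fin n) S}

/-- The isomorphism classes of `n`-element structures in `K` (for `K` closed under
isomorphism). -/
def unlabelled (K : StrClass) (n : ℕ) : Set (Quotient (isoSetoid (Fin n))) :=
  Quotient.mk (isoSetoid (Fin n)) '' labelled K n

/-- The structures in `K` that have the property `P`. -/
def sat (K P : StrClass) : StrClass := fun U S => K U S ∧ P U S

/-- The increasing enumeration of the positive integers `n` such that `K` has an `n`-element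
member. -/
noncomputable def sizes (K : StrClass) : ℕ → ℕ :=
  Nat.nth (fun n => 0 < n ∧ (unlabelled K n).Nonempty)

/-- The labelled probability of `P` in `K` exists and equals `r`. -/
def HasLabelledProb (K P : StrClass) (r : ℝ) : Prop :=
  Tendsto (fun k => ((labelled (sat K P) (sizes K k)).ncard : ℝ) /
    ((labelled K (sizes K k)).ncard : ℝ)) atTop (𝓝 r)

/-- The unlabelled probability of `P` in `K` exists and equals `r`. -/
def HasUnlabelledProb (K P : StrClass) (r : ℝ) : Prop :=
  Tendsto (fun k => ((unlabelled (sat K P) (sizes K k)).ncard : ℝ) /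
    ((unlabelled K (sizes K k)).ncard : ℝ)) atTop (𝓝 r)

/-- Almost all structures in `K` satisfy `P`. -/
def AlmostAll (K P : StrClass) : Prop := HasUnlabelledProb K P 1

/-! ### Nonassociative relation algebras and their atom structures -/

/-- Nonassociative relation algebras: Boolean algebras with a binary operation `comp` with
identity element `e` and a unary operation `conv` such that the triangle laws hold. -/
class NonassocRelAlg (A : Type*) extends BooleanAlgebra A where
  comp : A → A → A
  conv : A → A
  e : A
  e_comp : ∀ x, comp e x = x
  comp_e : ∀ x, comp x e = x
  triangle_left : ∀ x y z, comp x y ⊓ z = ⊥ ↔ comp (conv x) z ⊓ y = ⊥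
  triangle_right : ∀ x y z, comp x y ⊓ z = ⊥ ↔ comp z (conv y) ⊓ x = ⊥

namespace NonassocRelAlg

variable {A : Type*} [NonassocRelAlg A]

theorem le_of_disj {x y : A} (h : ∀ w, y ⊓ w = ⊥ → x ⊓ w = ⊥) : x ≤ y := by
  have := h yᶜ (inf_compl_self y)
  rwa [← disjoint_iff, disjoint_compl_right_iff] at this

theorem conv_conv (x : A) : conv (conv x) = x := by
  have h : ∀ w, x ⊓ w = ⊥ ↔ conv (conv x) ⊓ w = ⊥ := fun w => by
    have h1 := (triangle_left x e w).trans (triangle_left (conv x) w e)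
    rwa [comp_e, comp_e] at h1
  exact le_antisymm (le_of_disj fun w => (h w).1) (le_of_disj fun w => (h w).2)

theorem comp_mono_left {x x' : A} (y : A) (h : x ≤ x') : comp x y ≤ comp x' y := by
  refine le_of_disj fun w hw => ?_
  rw [triangle_right] at hw ⊢
  exact le_bot_iff.1 (hw ▸ inf_le_inf_left _ h)

theorem conv_mono {x y : A} (h : x ≤ y) : conv x ≤ conv y := by
  have key : ∀ x w : A, conv x ⊓ w = ⊥ ↔ comp x w ⊓ e = ⊥ := fun x w => by
    rw [triangle_left, comp_e]
  refine le_of_disj fun w hw => ?_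
  rw [key] at hw ⊢
  exact le_bot_iff.1 (hw ▸ inf_le_inf_right _ (comp_mono_left w h))

/-- The converse operation is an automorphism of the underlying order. -/
def convIso : A ≃o A where
  toFun := conv
  invFun := conv
  left_inv := conv_conv
  right_inv := conv_conv
  map_rel_iff' := by
    intro x y
    refine ⟨fun h => ?_, fun h => conv_mono h⟩
    have := conv_mono h
    simpa [conv_conv] using this

theorem isAtom_conv {a : A} (h : IsAtom a) : IsAtom (conv a) :=
  (OrderIso.isAtom_iff (convIso (A := A)) a).2 h

end NonassocRelAlg

open NonassocRelAlg in
/-- The atom structure of a nonassociative relation algebra. -/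
def atomStructure (A : Type*) [NonassocRelAlg A] : Str {a : A // IsAtom a} where
  f := fun a => ⟨conv a.1, isAtom_conv a.2⟩
  T := {t | t.2.2.1 ≤ comp t.1.1 t.2.1.1}
  I := {a | a.1 ≤ e}

/-- The class of (structures isomorphic to) atom structures of finite nonassociative relation
algebras. -/
def AtomStructures : StrClass := fun _ S =>
  ∃ (A : Type) (_ : NonassocRelAlg A), Finite A ∧ Isomorphic S (atomStructure A)

/-- The property of being symmetric and integral. -/
def SymmetricIntegral : StrClass := fun _ S => IsSymmetric S ∧ IsIntegral S

end FiniteNA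

/-! The proof counts. In a member of `FAS` the map `f` is an involution, and (P) says that `T`,
coded by the triples (a, b, f c), is a union of orbits of S₃ permuting entries, where odd
permutations also apply `f`. By Burnside's lemma there are C(N+2, 3) such orbits on N points if f =
id, and N/2 fewer for each point that `f` moves. In an integral structure on n points the triples
containing the identity are forced, so N = n - 1, and f = id with one fixed identity already yields
2^C(n+1, 3) labelled members of `FSIAS` (`le_ncard_FSIAS`).

Everything else is rarer. In the integral case each moved point costs a factor 2^((n-1)/2), against
n - 1 choices of its image (`ncard_nonsymmetric_le`). Having two or more identity elements costs at
least 2^(n²/36) (`ncard_nonintegral_le`). For n ≥ 12 so does a prescribed nontrivial automorphism of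
an integral structure, because it moves quadratically many orbits (`ncard_nonrigid_le`). The choices
of `I`, `f` and a permutation number only 2^O(n log n).

For unlabelled counts, n! times the number of isomorphism types is the number of pairs of a
structure and an automorphism (`ncard_image_mk_mul_card_perm`). Hence both probabilities are 1 once
the pairs other than (member of `FSIAS`, identity) are negligible against the labelled members of
`FSIAS`. Complex algebras show that the atom structures are exactly `FAS`. -/

namespace FiniteNA

/-! ### Orbits of triples under the twisted action of S₃ -/

section Triples

variable {V : Type*} {f : V → V}

/-- The homomorphism `ℤˣ →* Perm V` sending `-1` to the involution `f`. -/
def signHom (hf : Function.Involutive f) : ℤˣ →* Equiv.Perm V where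
  toFun u := if u = 1 then 1 else hf.toPerm
  map_one' := by simp
  map_mul' u v := by
    have h : hf.toPerm * hf.toPerm = 1 := by ext x; simp [hf x]
    rcases Int.units_eq_one_or u with rfl | rfl <;>
      rcases Int.units_eq_one_or v with rfl | rfl <;> simp [h]

/-- The symmetric group acts on triples by permuting the entries, odd permutations also apply
the involution `f` to every entry. -/
def tripleHom (hf : Function.Involutive f) : Equiv.Perm (Fin 3) →* Equiv.Perm (Fin 3 → V) where
  toFun π := Equiv.arrowCongr π (signHom hf (Equiv.Perm.sign π))
  map_one' := by rw [map_one, map_one]; rfl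
  map_mul' π ρ := by rw [map_mul, map_mul]; rfl

theorem tripleHom_apply (hf : Function.Involutive f) (π : Equiv.Perm (Fin 3)) (v : Fin 3 → V)
    (i : Fin 3) : tripleHom hf π v i =
      if Equiv.Perm.sign π = 1 then v (π⁻¹ i) else f (v (π⁻¹ i)) := by
  simp only [tripleHom, signHom, MonoidHom.coe_mk, OneHom.coe_mk, Equiv.arrowCongr_apply,
    Function.comp_apply]
  split_ifs <;> rfl

/-- The action of the symmetric group on triples that belongs to an involution. -/
abbrev tripleAction (hf : Function.Involutive f) :
    MulAction (Equiv.Perm (Fin 3)) (Fin 3 → V) :=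
  MulAction.compHom _ (tripleHom hf)

/-- Equivalence of triples under the action belonging to an involution. -/
abbrev tripleRel (hf : Function.Involutive f) : Setoid (Fin 3 → V) :=
  letI := tripleAction hf
  MulAction.orbitRel (Equiv.Perm (Fin 3)) (Fin 3 → V)

/-- Classes of triples under the action belonging to an involution. -/
abbrev TripleOrbit (hf : Function.Involutive f) : Type _ := Quotient (tripleRel hf)

theorem tripleOrbit_mk_eq {hf : Function.Involutive f} {v w : Fin 3 → V} :
    (Quotient.mk (tripleRel hf) v = Quotient.mk (tripleRel hf) w) ↔
      ∃ π, tripleHom hf π w = v := by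
  rw [Quotient.eq]
  exact Iff.rfl

theorem perm_fin_three_univ : (Finset.univ : Finset (Equiv.Perm (Fin 3))) =
    {1, Equiv.swap 0 1, Equiv.swap 0 2, Equiv.swap 1 2, finRotate 3, (finRotate 3)⁻¹} := by
  decide

/-- A transposition is odd, so a fixed triple has its two swapped entries exchanged by `f` and its
third entry fixed by `f`. -/
theorem card_fixed_swap (hf : Function.Involutive f) (i j k : Fin 3) (hij : i ≠ j) (hik : i ≠ k)
    (hjk : j ≠ k) :
    Nat.card {v : Fin 3 → V // tripleHom hf (Equiv.swap i j) v = v} =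
      Nat.card V * Nat.card {x // f x = x} := by
  rw [← Nat.card_prod]
  have hu : ∀ l, l = i ∨ l = j ∨ l = k := by decide +revert
  have key : ∀ v : Fin 3 → V, tripleHom hf (Equiv.swap i j) v = v ↔
      f (v i) = v j ∧ f (v k) = v k := by
    intro v
    rw [funext_iff]
    simp only [tripleHom_apply, Equiv.Perm.sign_swap hij, Equiv.swap_inv]
    constructor
    · intro h
      have h1 := h j
      have h2 := h k
      rw [Equiv.swap_apply_right] at h1
      rw [Equiv.swap_apply_of_ne_of_ne hik.symm hjk.symm] at h2
      exact ⟨by simpa using h1, by simpa using h2⟩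
    · rintro ⟨h1, h2⟩ l
      rcases hu l with rfl | rfl | rfl
      · rw [Equiv.swap_apply_left, ← h1, hf]; simp
      · rw [Equiv.swap_apply_right, ← h1]; simp
      · rw [Equiv.swap_apply_of_ne_of_ne hik.symm hjk.symm, h2]; simp
  refine Nat.card_congr
    { toFun := fun v => (v.1 i, ⟨v.1 k, ((key v.1).1 v.2).2⟩)
      invFun := fun p => ⟨fun l => if l = i then p.1 else if l = j then f p.1 else p.2.1, ?_⟩
      left_inv := ?_
      right_inv := ?_ }
  · rw [key]
    simp [hij.symm, hik.symm, hjk.symm, p.2.2]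
  · rintro ⟨v, hv⟩
    rw [key] at hv
    ext l
    rcases hu l with rfl | rfl | rfl
    · simp
    · simp [hij.symm, hv.1]
    · simp [hik.symm, hjk.symm]
  · rintro ⟨a, b⟩
    simp [hik.symm, hjk.symm]

/-- A 3-cycle is even, so `f` does not enter and exactly the constant triples are fixed. -/
theorem card_fixed_cycle (hf : Function.Involutive f) (π : Equiv.Perm (Fin 3))
    (h : π = finRotate 3 ∨ π = (finRotate 3)⁻¹) :
    Nat.card {v : Fin 3 → V // tripleHom hf π v = v} = Nat.card V := by
  have hs : Equiv.Perm.sign π = 1 := by rcases h with rfl | rfl <;> decide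
  have key : ∀ v : Fin 3 → V, tripleHom hf π v = v ↔ v 1 = v 0 ∧ v 2 = v 0 := by
    intro v
    rw [funext_iff]
    simp only [tripleHom_apply, hs, if_true, Fin.forall_fin_succ]
    rcases h with rfl | rfl
    · have h0 : (finRotate 3)⁻¹ 0 = 2 := by decide
      have h1 : (finRotate 3)⁻¹ (Fin.succ 0) = 0 := by decide
      have h2 : (finRotate 3)⁻¹ (Fin.succ (Fin.succ 0)) = 1 := by decide
      simp only [h0, h1, h2]
      constructor
      · rintro ⟨h, h', -⟩; exact ⟨h'.symm, h⟩
      · rintro ⟨h, h'⟩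
        exact ⟨h', h.symm, h.trans h'.symm, fun i => i.elim0⟩
    · have h0 : (finRotate 3)⁻¹⁻¹ 0 = 1 := by decide
      have h1 : (finRotate 3)⁻¹⁻¹ (Fin.succ 0) = 2 := by decide
      have h2 : (finRotate 3)⁻¹⁻¹ (Fin.succ (Fin.succ 0)) = 0 := by decide
      simp only [h0, h1, h2]
      constructor
      · rintro ⟨h, h', -⟩; exact ⟨h, h'.trans h⟩
      · rintro ⟨h, h'⟩
        exact ⟨h, h'.trans h.symm, h'.symm, fun i => i.elim0⟩
  refine Nat.card_congr
    { toFun := fun v => v.1 0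
      invFun := fun x => ⟨fun _ => x, by rw [key]; simp⟩
      left_inv := ?_
      right_inv := fun _ => rfl }
  rintro ⟨v, hv⟩
  rw [key] at hv
  ext l
  fin_cases l
  · rfl
  · exact hv.1.symm
  · exact hv.2.symm

/-- Burnside's count of the classes of triples. -/
theorem six_mul_card_tripleOrbit [Finite V] (hf : Function.Involutive f) :
    6 * Nat.card (TripleOrbit hf) =
      Nat.card V ^ 3 + 3 * (Nat.card V * Nat.card {x // f x = x}) + 2 * Nat.card V := by
  classical
  have := Fintype.ofFinite V
  let _ := tripleAction hf
  have : Fintype (Quotient (MulAction.orbitRel (Equiv.Perm (Fin 3)) (Fin 3 → V))) :=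
    Fintype.ofFinite _
  have h := MulAction.sum_card_fixedBy_eq_card_orbits_mul_card_group (Equiv.Perm (Fin 3))
    (Fin 3 → V)
  have hc : Fintype.card (Equiv.Perm (Fin 3)) = 6 := by decide
  have hfix : ∀ π : Equiv.Perm (Fin 3), Fintype.card (MulAction.fixedBy (Fin 3 → V) π) =
      Nat.card {v : Fin 3 → V // tripleHom hf π v = v} := by
    intro π
    rw [← Nat.card_eq_fintype_card]
    rfl
  rw [hc, ← Nat.card_eq_fintype_card, mul_comm] at h
  refine h.symm.trans ?_
  simp only [hfix]
  rw [perm_fin_three_univ, Finset.sum_insert (by decide), Finset.sum_insert (by decide),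
    Finset.sum_insert (by decide), Finset.sum_insert (by decide), Finset.sum_insert (by decide),
    Finset.sum_singleton, card_fixed_swap hf 0 1 2 (by decide) (by decide) (by decide),
    card_fixed_swap hf 0 2 1 (by decide) (by decide) (by decide),
    card_fixed_swap hf 1 2 0 (by decide) (by decide) (by decide),
    card_fixed_cycle hf _ (Or.inl rfl), card_fixed_cycle hf _ (Or.inr rfl)]
  have h1 : Nat.card {v : Fin 3 → V // tripleHom hf 1 v = v} = Nat.card V ^ 3 := by
    rw [Nat.card_congr (Equiv.subtypeUnivEquiv (fun v => by simp)), Nat.card_fun]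
    simp
  rw [h1]
  ring

/-- The ternary relation determined by a set of classes of triples. -/
def relOfOrbits (hf : Function.Involutive f) (A : Set (TripleOrbit hf)) : Set (V × V × V) :=
  {p | Quotient.mk (tripleRel hf) ![p.1, p.2.1, f p.2.2] ∈ A}

theorem mem_relOfOrbits {hf : Function.Involutive f} {A : Set (TripleOrbit hf)} {a b c : V} :
    (a, b, c) ∈ relOfOrbits hf A ↔ Quotient.mk (tripleRel hf) ![a, b, f c] ∈ A := Iff.rfl

theorem mk_mem_iff_relOfOrbits {hf : Function.Involutive f} {A : Set (TripleOrbit hf)}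
    (v : Fin 3 → V) :
    Quotient.mk (tripleRel hf) v ∈ A ↔ (v 0, v 1, f (v 2)) ∈ relOfOrbits hf A := by
  rw [mem_relOfOrbits, hf]
  have : ![v 0, v 1, v 2] = v := by ext l; fin_cases l <;> rfl
  rw [this]

theorem relOfOrbits_injective (hf : Function.Involutive f) :
    Function.Injective (relOfOrbits hf) := by
  intro A B h
  ext q
  induction q using Quotient.inductionOn with
  | h v => rw [mk_mem_iff_relOfOrbits, h, ← mk_mem_iff_relOfOrbits]

theorem tripleHom_swap_one_two (hf : Function.Involutive f) (v : Fin 3 → V) :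
    tripleHom hf (Equiv.swap 1 2) v = ![f (v 0), f (v 2), f (v 1)] := by
  have hs : Equiv.Perm.sign (Equiv.swap (1 : Fin 3) 2) ≠ 1 := by decide
  ext l
  rw [tripleHom_apply, if_neg hs]
  fin_cases l <;> rfl

theorem tripleHom_swap_zero_two (hf : Function.Involutive f) (v : Fin 3 → V) :
    tripleHom hf (Equiv.swap 0 2) v = ![f (v 2), f (v 1), f (v 0)] := by
  have hs : Equiv.Perm.sign (Equiv.swap (0 : Fin 3) 2) ≠ 1 := by decide
  ext l
  rw [tripleHom_apply, if_neg hs]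
  fin_cases l <;> rfl

/-- After (a, b, c) is coded as (a, b, f c), the two implications in (P) are closure under the
twisted transpositions (1 2) and (0 2), which generate S₃. -/
theorem axP_iff_mem_range_relOfOrbits (hf : Function.Involutive f) (P : Set (V × V × V))
    (I : Set V) : AxP ⟨f, P, I⟩ ↔ P ∈ Set.range (relOfOrbits hf) := by
  constructor
  · intro h
    let Q : Set (Fin 3 → V) := {v | (v 0, v 1, f (v 2)) ∈ P}
    have h12 : ∀ v ∈ Q, tripleHom hf (Equiv.swap 1 2) v ∈ Q := by
      intro v hv
      rw [tripleHom_swap_one_two]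
      have := (h _ _ _ hv).1
      simpa [Q, hf (v 1)] using this
    have h02 : ∀ v ∈ Q, tripleHom hf (Equiv.swap 0 2) v ∈ Q := by
      intro v hv
      rw [tripleHom_swap_zero_two]
      have := (h _ _ _ hv).2
      simpa [Q, hf (v 0)] using this
    have hmul : ∀ π ρ : Equiv.Perm (Fin 3), (∀ v ∈ Q, tripleHom hf π v ∈ Q) →
        (∀ v ∈ Q, tripleHom hf ρ v ∈ Q) → ∀ v ∈ Q, tripleHom hf (π * ρ) v ∈ Q := by
      intro π ρ h1 h2 v hv
      rw [map_mul]
      exact h1 _ (h2 _ hv)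
    have hr : ∀ v ∈ Q, tripleHom hf (finRotate 3) v ∈ Q := by
      have : finRotate 3 = Equiv.swap (1 : Fin 3) 2 * Equiv.swap 0 2 := by decide
      rw [this]
      exact hmul _ _ h12 h02
    have hri : ∀ v ∈ Q, tripleHom hf (finRotate 3)⁻¹ v ∈ Q := by
      have : (finRotate 3)⁻¹ = Equiv.swap (0 : Fin 3) 2 * Equiv.swap 1 2 := by decide
      rw [this]
      exact hmul _ _ h02 h12
    have h01 : ∀ v ∈ Q, tripleHom hf (Equiv.swap 0 1) v ∈ Q := by
      have : Equiv.swap (0 : Fin 3) 1 = finRotate 3 * Equiv.swap (1 : Fin 3) 2 := by decide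
      rw [this]
      exact hmul _ _ hr h12
    have hall : ∀ π, ∀ v ∈ Q, tripleHom hf π v ∈ Q := by
      intro π
      have hπ : π ∈ (Finset.univ : Finset (Equiv.Perm (Fin 3))) := Finset.mem_univ _
      rw [perm_fin_three_univ] at hπ
      simp only [Finset.mem_insert, Finset.mem_singleton] at hπ
      rcases hπ with rfl | rfl | rfl | rfl | rfl | rfl
      · simp
      · exact h01
      · exact h02
      · exact h12
      · exact hr
      · exact hri
    refine ⟨Quotient.mk (tripleRel hf) '' Q, ?_⟩
    ext ⟨a, b, c⟩
    rw [mem_relOfOrbits]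
    constructor
    · rintro ⟨v, hv, he⟩
      obtain ⟨π, hπ⟩ := tripleOrbit_mk_eq.1 he.symm
      have := hall π v hv
      rw [hπ] at this
      simpa [Q, hf c] using this
    · intro hp
      exact ⟨_, by simpa [Q, hf c] using hp, rfl⟩
  · rintro ⟨A, rfl⟩ a b c hp
    change (a, b, c) ∈ relOfOrbits hf A at hp
    change (f a, c, b) ∈ relOfOrbits hf A ∧ (c, f b, a) ∈ relOfOrbits hf A
    rw [mem_relOfOrbits] at hp
    constructor
    · rw [mem_relOfOrbits]
      convert hp using 1
      refine tripleOrbit_mk_eq.2 ⟨Equiv.swap 1 2, ?_⟩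
      rw [tripleHom_swap_one_two]
      simp [hf c]
    · rw [mem_relOfOrbits]
      convert hp using 1
      refine tripleOrbit_mk_eq.2 ⟨Equiv.swap 0 2, ?_⟩
      rw [tripleHom_swap_zero_two]
      simp [hf c]

/-- (P) does not mention `I`, so `∅` is only a placeholder. -/
theorem ncard_axP [Finite V] (hf : Function.Involutive f) :
    {P : Set (V × V × V) | AxP ⟨f, P, ∅⟩}.ncard = 2 ^ Nat.card (TripleOrbit hf) := by
  have : {P : Set (V × V × V) | AxP ⟨f, P, ∅⟩} = relOfOrbits hf '' Set.univ := by
    ext P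
    rw [Set.image_univ]
    exact axP_iff_mem_range_relOfOrbits hf P ∅
  rw [this, Set.ncard_image_of_injective _ (relOfOrbits_injective hf), Set.ncard_univ]
  have := Fintype.ofFinite (TripleOrbit hf)
  simp

end Triples

/-! ### Subsets invariant under a permutation -/

/-- A permutation has a set of points disjoint from its image that has at least a third of the
size of the support. -/
theorem exists_disjoint_image {Ω : Type*} [Fintype Ω] [DecidableEq Ω] (τ : Equiv.Perm Ω) :
    ∃ W : Finset Ω, Disjoint W (W.image τ) ∧ τ.support.card ≤ 3 * W.card := by
  obtain ⟨W, hW, hmax⟩ := ((Finset.univ : Finset (Finset Ω)).filter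
    fun W => Disjoint W (W.image τ)).exists_maximal ⟨∅, by simp⟩
  rw [Finset.mem_filter] at hW
  refine ⟨W, hW.2, ?_⟩
  have hsub : τ.support ⊆ W ∪ (W.image τ ∪ W.image τ.symm) := by
    intro q hq
    by_contra hn
    simp only [Finset.mem_union, not_or] at hn
    obtain ⟨h1, h2, h3⟩ := hn
    have h3' : τ q ∉ W := fun h => h3 (Finset.mem_image.2 ⟨τ q, h, by simp⟩)
    have hq' : τ q ≠ q := by simpa using hq
    -- A moved point outside `W`, its image and its preimage could be added to `W`, against
    -- maximality.
    refine h1 (hmax (y := insert q W) ?_ (Finset.subset_insert _ _) (Finset.mem_insert_self _ _))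
    simp only [Finset.mem_filter, Finset.mem_univ, true_and, Finset.image_insert,
      Finset.disjoint_insert_left, Finset.disjoint_insert_right, Finset.mem_insert, not_or]
    exact ⟨⟨hq', h3'⟩, h2, hW.2⟩
  calc τ.support.card ≤ _ := Finset.card_le_card hsub
    _ ≤ W.card + ((W.image τ).card + (W.image τ.symm).card) :=
        (Finset.card_union_le _ _).trans (Nat.add_le_add_left (Finset.card_union_le _ _) _)
    _ ≤ W.card + (W.card + W.card) := add_le_add_right (add_le_add Finset.card_image_le Finset.card_image_le) _
    _ = 3 * W.card := by ring

/-- An invariant set is determined by its trace outside τ(W): membership on τ(W) is read off from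
`W`, which is disjoint from τ(W). -/
theorem ncard_invariant_mul_le {Ω : Type*} [Fintype Ω] [DecidableEq Ω] (τ : Equiv.Perm Ω)
    (W : Finset Ω) (hW : Disjoint W (W.image τ)) :
    {A : Set Ω | ∀ q, q ∈ A ↔ τ q ∈ A}.ncard * 2 ^ W.card ≤ 2 ^ Fintype.card Ω := by
  have h1 : {A : Set Ω | ∀ q, q ∈ A ↔ τ q ∈ A}.ncard ≤
      (𝒫 ((↑(W.image τ) : Set Ω)ᶜ)).ncard := by
    refine Set.ncard_le_ncard_of_injOn (fun A => A ∩ (↑(W.image τ) : Set Ω)ᶜ)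
      (fun A _ => Set.inter_subset_right) ?_ (Set.toFinite _)
    intro A hA B hB hAB
    have h0 : ∀ q, q ∉ W.image τ → (q ∈ A ↔ q ∈ B) := by
      intro q hq
      have hm : q ∈ (↑(W.image τ) : Set Ω)ᶜ := fun h => hq (Finset.mem_coe.1 h)
      have := Set.ext_iff.1 hAB q
      simpa only [Set.mem_inter_iff, hm, and_true] using this
    ext q
    by_cases hq : q ∈ W.image τ
    · obtain ⟨w, hw, rfl⟩ := Finset.mem_image.1 hq
      rw [← hA w, ← hB w]
      exact h0 w (Finset.disjoint_left.1 hW hw)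
    · exact h0 q hq
  have h2 : (𝒫 ((↑(W.image τ) : Set Ω)ᶜ)).ncard = 2 ^ (Fintype.card Ω - W.card) := by
    rw [Set.ncard_powerset _ (Set.toFinite _), ← Finset.coe_compl, Set.ncard_coe_finset,
      Finset.card_compl, Finset.card_image_of_injective _ τ.injective]
  calc _ ≤ 2 ^ (Fintype.card Ω - W.card) * 2 ^ W.card := by
        rw [← h2]; gcongr
    _ = 2 ^ Fintype.card Ω := by
        rw [← pow_add, Nat.sub_add_cancel (Finset.card_le_univ W)]

/-! ### Orbits moved by an automorphism, and the orbit count -/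

section Automorphisms

variable {V : Type*} {f : V → V}

theorem tripleHom_comp (hf : Function.Involutive f) {σ : Equiv.Perm V}
    (hσ : ∀ a, σ (f a) = f (σ a)) (π : Equiv.Perm (Fin 3)) (v : Fin 3 → V) :
    tripleHom hf π (σ ∘ v) = σ ∘ tripleHom hf π v := by
  ext l
  rw [Function.comp_apply, tripleHom_apply, tripleHom_apply]
  split_ifs
  · rfl
  · rw [hσ]; rfl

/-- The permutation of the classes of triples induced by an automorphism. -/
def orbitPerm (hf : Function.Involutive f) {σ : Equiv.Perm V} (hσ : ∀ a, σ (f a) = f (σ a)) :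
    Equiv.Perm (TripleOrbit hf) :=
  Quotient.congr (Equiv.arrowCongr (Equiv.refl _) σ) (by
    intro v w
    change (∃ π, tripleHom hf π w = v) ↔ (∃ π, tripleHom hf π (σ ∘ w) = σ ∘ v)
    refine exists_congr fun π => ?_
    rw [tripleHom_comp hf hσ]
    exact ⟨fun h => by rw [h], fun h => σ.injective.comp_left h⟩)

theorem orbitPerm_mk (hf : Function.Involutive f) {σ : Equiv.Perm V}
    (hσ : ∀ a, σ (f a) = f (σ a)) (v : Fin 3 → V) :
    orbitPerm hf hσ (Quotient.mk (tripleRel hf) v) = Quotient.mk (tripleRel hf) (σ ∘ v) := rfl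

/-- Each of the six hypotheses excludes one of the six permutations that could carry (x, b, c) to
its image under σ. -/
theorem orbitPerm_mk_ne (hf : Function.Involutive f) {σ : Equiv.Perm V}
    (hσ : ∀ a, σ (f a) = f (σ a)) {x b c : V} (hx : σ x ≠ x) (hb : b ≠ σ x) (hb' : b ≠ f (σ x))
    (hc : c ≠ σ x) (hc' : c ≠ f (σ x)) (hc'' : c ≠ f (σ b)) :
    orbitPerm hf hσ (Quotient.mk (tripleRel hf) ![x, b, c]) ≠
      Quotient.mk (tripleRel hf) ![x, b, c] := by
  rw [orbitPerm_mk, Ne, tripleOrbit_mk_eq]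
  rintro ⟨π, hπ⟩
  have h0 := congrFun hπ 0
  have h1 := congrFun hπ 1
  rw [tripleHom_apply] at h0 h1
  have inv : ∀ {u v}, f u = v → u = f v := fun h => by rw [← h, hf]
  have hp : π ∈ (Finset.univ : Finset (Equiv.Perm (Fin 3))) := Finset.mem_univ _
  rw [perm_fin_three_univ] at hp
  simp only [Finset.mem_insert, Finset.mem_singleton] at hp
  rcases hp with rfl | rfl | rfl | rfl | rfl | rfl
  · exact hx (by simpa using h0.symm)
  · rw [if_neg (by decide)] at h0
    exact hb' (inv h0)
  · rw [if_neg (by decide)] at h0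
    exact hc' (inv h0)
  · rw [if_neg (by decide)] at h1
    exact hc'' (inv h1)
  · rw [if_pos (by decide)] at h0
    exact hc h0
  · rw [if_pos (by decide)] at h0
    exact hb h0

/-- Fix a moved point x. A pair (b, c) for which (x, b, c) has a moved orbit only has to avoid two
values for b and then three for c. An orbit has at most six triples, so it arises from at most six
pairs. -/
theorem le_card_support_orbitPerm [Fintype V] (hf : Function.Involutive f)
    [Fintype (TripleOrbit hf)] [DecidableEq (TripleOrbit hf)] {σ : Equiv.Perm V}
    (hσ : ∀ a, σ (f a) = f (σ a)) (hne : σ ≠ 1) :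
    (Fintype.card V - 2) * (Fintype.card V - 3) ≤ 6 * (orbitPerm hf hσ).support.card := by
  classical
  obtain ⟨x, hx⟩ : ∃ x, σ x ≠ x := by
    by_contra! h
    exact hne (Equiv.ext h)
  let B : Finset V := Finset.univ \ {σ x, f (σ x)}
  let C : V → Finset V := fun b => Finset.univ \ {σ x, f (σ x), f (σ b)}
  let Y : Finset (Σ _ : V, V) := B.sigma C
  let g : (Σ _ : V, V) → TripleOrbit hf := fun p => Quotient.mk (tripleRel hf) ![x, p.1, p.2]
  have hY : (Fintype.card V - 2) * (Fintype.card V - 3) ≤ Y.card := by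
    have hB : Fintype.card V - 2 ≤ B.card := by
      refine le_trans ?_ (Finset.le_card_sdiff _ _)
      exact Nat.sub_le_sub_left Finset.card_le_two _
    have hC : ∀ b, Fintype.card V - 3 ≤ (C b).card := by
      intro b
      refine le_trans ?_ (Finset.le_card_sdiff _ _)
      exact Nat.sub_le_sub_left Finset.card_le_three _
    rw [Finset.card_sigma]
    calc _ ≤ B.card * (Fintype.card V - 3) := Nat.mul_le_mul_right _ hB
      _ = ∑ b ∈ B, (Fintype.card V - 3) := by simp
      _ ≤ _ := Finset.sum_le_sum fun b _ => hC b
  refine hY.trans ((Finset.card_le_mul_card_image (f := g) Y 6 ?_).trans ?_)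
  · intro q _
    induction q using Quotient.inductionOn with
    | h w =>
      have h6 : (Finset.univ.image fun π => tripleHom hf π w).card ≤ 6 :=
        Finset.card_image_le.trans (by decide)
      refine le_trans (Finset.card_le_card_of_injOn
        (fun p : (Σ _ : V, V) => (![x, p.1, p.2] : Fin 3 → V)) ?_ ?_) h6
      · intro p hp
        have hp2 := (Finset.mem_filter.1 (Finset.mem_coe.1 hp)).2
        obtain ⟨π, hπ⟩ := tripleOrbit_mk_eq.1 hp2
        exact Finset.mem_coe.2 (Finset.mem_image.2 ⟨π, Finset.mem_univ _, hπ⟩)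
      · rintro ⟨b, c⟩ _ ⟨b', c'⟩ _ h
        have h1 : b = b' := congrFun h 1
        have h2 : c = c' := congrFun h 2
        rw [h1, h2]
  · refine Nat.mul_le_mul_left _ (Finset.card_le_card ?_)
    intro q hq
    obtain ⟨⟨b, c⟩, hp, rfl⟩ := Finset.mem_image.1 hq
    rw [Finset.mem_sigma] at hp
    simp only [B, C, Finset.mem_sdiff, Finset.mem_univ, true_and, Finset.mem_insert,
      Finset.mem_singleton, not_or] at hp
    rw [Equiv.Perm.mem_support]
    exact orbitPerm_mk_ne hf hσ hx hp.1.1 hp.1.2 hp.2.1 hp.2.2.1 hp.2.2.2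

/-- Few relations that are closed under the cycle law admit a given nontrivial automorphism. -/
theorem exists_ncard_axP_invariant_mul_le [Finite V] (hf : Function.Involutive f)
    {σ : Equiv.Perm V} (hσ : ∀ a, σ (f a) = f (σ a)) (hne : σ ≠ 1) :
    ∃ w, (Nat.card V - 2) * (Nat.card V - 3) ≤ 18 * w ∧
      {P : Set (V × V × V) | AxP ⟨f, P, ∅⟩ ∧
        ∀ a b c, (a, b, c) ∈ P ↔ (σ a, σ b, σ c) ∈ P}.ncard * 2 ^ w ≤
      2 ^ Nat.card (TripleOrbit hf) := by
  classical
  have := Fintype.ofFinite V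
  have := Fintype.ofFinite (TripleOrbit hf)
  obtain ⟨W, hW, hle⟩ := exists_disjoint_image (orbitPerm hf hσ)
  -- 18 = 6 · 3: six pairs per orbit, and a third of the support in `W`.
  refine ⟨W.card, ?_, ?_⟩
  · have := le_card_support_orbitPerm hf hσ hne
    rw [Nat.card_eq_fintype_card]
    omega
  · rw [Nat.card_eq_fintype_card]
    refine le_trans (Nat.mul_le_mul_right _ ?_)
      (ncard_invariant_mul_le (orbitPerm hf hσ) W hW)
    have hsub : {P : Set (V × V × V) | AxP ⟨f, P, ∅⟩ ∧
        ∀ a b c, (a, b, c) ∈ P ↔ (σ a, σ b, σ c) ∈ P} ⊆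
        relOfOrbits hf '' {A | ∀ q, q ∈ A ↔ orbitPerm hf hσ q ∈ A} := by
      rintro P ⟨hP, hinv⟩
      obtain ⟨A, rfl⟩ := (axP_iff_mem_range_relOfOrbits hf P ∅).1 hP
      refine ⟨A, ?_, rfl⟩
      intro q
      induction q using Quotient.inductionOn with
      | h v =>
        rw [orbitPerm_mk, mk_mem_iff_relOfOrbits, mk_mem_iff_relOfOrbits, hinv, hσ]
        rfl
    exact (Set.ncard_le_ncard hsub (Set.toFinite _)).trans
      (Set.ncard_image_le (Set.toFinite _))

theorem six_mul_choose_three (N : ℕ) : 6 * (N + 2).choose 3 = N ^ 3 + 3 * N ^ 2 + 2 * N := by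
  induction N with
  | zero => rfl
  | succ N ih =>
    have h1 : (N + 1 + 2).choose 3 = (N + 2).choose 2 + (N + 2).choose 3 :=
      Nat.choose_succ_succ _ _
    have h2 : (N + 2).choose 2 * 2 = (N + 2) * (N + 1) := by
      rw [Nat.choose_two_right]
      exact Nat.div_mul_cancel (Nat.even_mul_pred_self (N + 2)).two_dvd
    rw [h1, mul_add, ih]
    nlinarith

/-- For f = id the orbits are the multisets of size 3. Writing the number of fixed points in
Burnside's count as N minus the number of moved points shows a loss of N/2 per moved point; doubling
avoids the fraction. -/
theorem two_mul_card_tripleOrbit [Finite V] (hf : Function.Involutive f) :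
    2 * Nat.card (TripleOrbit hf) + Nat.card V * Nat.card {x // f x ≠ x} =
      2 * (Nat.card V + 2).choose 3 := by
  classical
  have h1 := six_mul_card_tripleOrbit hf
  have h2 := six_mul_choose_three (Nat.card V)
  have h3 : Nat.card V = Nat.card {x // f x = x} + Nat.card {x // f x ≠ x} := by
    rw [← Nat.card_sum]
    exact Nat.card_congr (Equiv.sumCompl _).symm
  have h4 : Nat.card V ^ 2 = Nat.card V * Nat.card {x // f x = x} +
      Nat.card V * Nat.card {x // f x ≠ x} := by
    rw [← mul_add, ← h3, sq]
  omega

theorem card_tripleOrbit_le [Finite V] (hf : Function.Involutive f) :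
    Nat.card (TripleOrbit hf) ≤ (Nat.card V + 2).choose 3 := by
  have := two_mul_card_tripleOrbit hf
  omega

end Automorphisms

/-! ### The relation of a structure in `FAS` -/

section Structure

variable {U : Type*} {S : Str U}

theorem AxI.eq_of_mem (hI : AxI S) {a b i : U} (hi : i ∈ S.I) (h : (a, i, b) ∈ S.T) : a = b :=
  (hI a b).2 ⟨i, hi, h⟩

/-- Two uses of the first half of (P) take (a, i, a) to (f (f a), i, a), and (I) applies. -/
theorem AxP.involutive (hP : AxP S) (hI : AxI S) : Function.Involutive S.f := by
  intro a
  obtain ⟨i, hi, h⟩ := (hI a a).1 rfl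
  exact hI.eq_of_mem hi (hP _ _ _ (hP _ _ _ h).1).1

theorem AxP.f_eq_of_mem (hP : AxP S) (hI : AxI S) {i : U} (hi : i ∈ S.I) : S.f i = i := by
  obtain ⟨j, hj, h⟩ := (hI i i).1 rfl
  have h2 : S.f i = j := hI.eq_of_mem hi (hP _ _ _ h).1
  rw [← h2] at h
  have h3 := (hP _ _ _ h).2
  rw [hP.involutive hI] at h3
  exact hI.eq_of_mem hi (hP _ _ _ h3).1

theorem AxP.mem_iff_left (hP : AxP S) (hI : AxI S) (a b c : U) :
    (a, b, c) ∈ S.T ↔ (S.f a, c, b) ∈ S.T := by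
  refine ⟨fun h => (hP _ _ _ h).1, fun h => ?_⟩
  have := (hP _ _ _ h).1
  rwa [hP.involutive hI] at this

theorem AxP.mem_iff_right (hP : AxP S) (hI : AxI S) (a b c : U) :
    (a, b, c) ∈ S.T ↔ (c, S.f b, a) ∈ S.T := by
  refine ⟨fun h => (hP _ _ _ h).2, fun h => ?_⟩
  have := (hP _ _ _ h).2
  rwa [hP.involutive hI] at this

theorem AxP.f_not_mem (hP : AxP S) (hI : AxI S) (a : U) (ha : a ∉ S.I) : S.f a ∉ S.I := by
  intro h
  have := hP.f_eq_of_mem hI h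
  rw [hP.involutive hI] at this
  exact ha (this ▸ h)

/-- (P) turns (a, j, a) into (f a, a, j). As a is an identity element fixed by `f`, this forces j =
a, and (I) guarantees that some j occurs. -/
theorem AxI.mem_identity_iff (hP : AxP S) (hI : AxI S) {a i : U} (ha : a ∈ S.I) :
    (a, i, a) ∈ S.T ↔ i = a := by
  have key : ∀ j, (a, j, a) ∈ S.T → j = a := by
    intro j h
    have := hI.eq_of_mem ha (hP _ _ _ h).1
    rw [hP.f_eq_of_mem hI ha] at this
    exact this.symm
  refine ⟨key i, ?_⟩
  rintro rfl
  obtain ⟨j, _, h⟩ := (hI i i).1 rfl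
  have := key j h
  rwa [this] at h

/-- A structure in `FAS` is determined by its triples of non-identity elements and by the
triples `(a, i, a)` with `i` an identity element and `a` not. -/
theorem T_eq_of_restrict_eq {f : U → U} {I : Set U} {T T' : Set (U × U × U)}
    (hP : AxP ⟨f, T, I⟩) (hI : AxI ⟨f, T, I⟩) (hP' : AxP ⟨f, T', I⟩) (hI' : AxI ⟨f, T', I⟩)
    (h1 : ∀ a b c, a ∉ I → b ∉ I → c ∉ I → ((a, b, c) ∈ T ↔ (a, b, c) ∈ T'))
    (h2 : ∀ a i, a ∉ I → i ∈ I → ((a, i, a) ∈ T ↔ (a, i, a) ∈ T')) : T = T' := by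
  have hmid : ∀ a b c, b ∈ I → ((a, b, c) ∈ T ↔ (a, b, c) ∈ T') := by
    intro a b c hb
    by_cases hac : a = c
    · subst hac
      by_cases ha : a ∈ I
      · exact (hI.mem_identity_iff hP ha).trans (hI'.mem_identity_iff hP' ha).symm
      · exact h2 a b ha hb
    · exact iff_of_false (fun h => hac (hI.eq_of_mem hb h)) (fun h => hac (hI'.eq_of_mem hb h))
  -- (P) moves an identity element from the last place to the middle, and from the first place to
  -- the last.
  have hright : ∀ a b c, c ∈ I → ((a, b, c) ∈ T ↔ (a, b, c) ∈ T') := by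
    intro a b c hc
    exact (hP.mem_iff_left hI a b c).trans
      ((hmid _ _ _ hc).trans (hP'.mem_iff_left hI' a b c).symm)
  have hleft : ∀ a b c, a ∈ I → ((a, b, c) ∈ T ↔ (a, b, c) ∈ T') := by
    intro a b c ha
    exact (hP.mem_iff_right hI a b c).trans
      ((hright _ _ _ ha).trans (hP'.mem_iff_right hI' a b c).symm)
  ext ⟨a, b, c⟩
  by_cases ha : a ∈ I
  · exact hleft a b c ha
  by_cases hb : b ∈ I
  · exact hmid a b c hb
  by_cases hc : c ∈ I
  · exact hright a b c hc
  exact h1 a b c ha hb hc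

/-- The restriction of a ternary relation to the complement of `I`. -/
def restrictRel (I : Set U) (T : Set (U × U × U)) :
    Set ({a // a ∉ I} × {a // a ∉ I} × {a // a ∉ I}) :=
  {p | (p.1.1, p.2.1.1, p.2.2.1) ∈ T}

theorem mem_restrictRel {I : Set U} {T : Set (U × U × U)} {a b c : {a // a ∉ I}} :
    (a, b, c) ∈ restrictRel I T ↔ (a.1, b.1, c.1) ∈ T := Iff.rfl

theorem AxP.restrictRel {f : U → U} {I : Set U} {T : Set (U × U × U)} (hP : AxP ⟨f, T, I⟩)
    (h : ∀ a, a ∉ I → f a ∉ I) : AxP ⟨Subtype.map f h, restrictRel I T, ∅⟩ :=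
  fun a b c hT => hP a.1 b.1 c.1 hT

theorem involutive_subtypeMap {f : U → U} {I : Set U} (hf : Function.Involutive f)
    (h : ∀ a, a ∉ I → f a ∉ I) : Function.Involutive (Subtype.map f h) :=
  fun a => Subtype.ext (hf a.1)

/-- The number of ternary relations that turn `f` and `I` into a member of `FAS`. -/
theorem ncard_T_le [Finite U] (f : U → U) (I : Set U) :
    {T : Set (U × U × U) | AxP ⟨f, T, I⟩ ∧ AxI ⟨f, T, I⟩}.ncard ≤
      2 ^ ((Nat.card {a // a ∉ I} + 2).choose 3 + Nat.card {a // a ∉ I} * I.ncard) := by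
  rcases Set.eq_empty_or_nonempty {T : Set (U × U × U) | AxP ⟨f, T, I⟩ ∧ AxI ⟨f, T, I⟩} with
    h0 | ⟨T₀, hP₀, hI₀⟩
  · rw [h0]; simp
  have hf : Function.Involutive f := hP₀.involutive hI₀
  have hfI : ∀ a, a ∉ I → f a ∉ I := hP₀.f_not_mem hI₀
  have hV := involutive_subtypeMap hf hfI
  -- The free data are a relation off `I` that obeys (P), and at most one bit for each pair of a
  -- non-identity and an identity element.
  let Φ : Set (U × U × U) → Set ({a // a ∉ I} × {a // a ∉ I} × {a // a ∉ I}) ×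
      Set ({a // a ∉ I} × I) := fun T => (restrictRel I T, {p | (p.1.1, p.2.1, p.1.1) ∈ T})
  have h1 : {T : Set (U × U × U) | AxP ⟨f, T, I⟩ ∧ AxI ⟨f, T, I⟩}.ncard ≤
      ({P | AxP ⟨Subtype.map f hfI, P, ∅⟩} ×ˢ (Set.univ : Set (Set ({a // a ∉ I} × I)))).ncard := by
    refine Set.ncard_le_ncard_of_injOn Φ ?_ ?_ (Set.toFinite _)
    · rintro T ⟨hP, hI⟩
      exact ⟨hP.restrictRel hfI, Set.mem_univ _⟩
    · rintro T ⟨hP, hI⟩ T' ⟨hP', hI'⟩ h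
      refine T_eq_of_restrict_eq hP hI hP' hI' ?_ ?_
      · intro a b c ha hb hc
        have := Set.ext_iff.1 (congrArg Prod.fst h) (⟨a, ha⟩, ⟨b, hb⟩, ⟨c, hc⟩)
        exact this
      · intro a i ha hi
        have := Set.ext_iff.1 (congrArg Prod.snd h) (⟨a, ha⟩, ⟨i, hi⟩)
        exact this
  refine h1.trans ?_
  have h2 : Nat.card (Set ({a // a ∉ I} × I)) = 2 ^ (Nat.card {a // a ∉ I} * I.ncard) := by
    rw [← Set.ncard_univ, ← Set.powerset_univ, Set.ncard_powerset _ (Set.toFinite _),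
      Set.ncard_univ, Nat.card_prod, Nat.card_coe_set_eq]
  rw [Set.ncard_prod, ncard_axP hV, Set.ncard_univ, h2, pow_add]
  exact Nat.mul_le_mul_right _ (Nat.pow_le_pow_right two_pos (card_tripleOrbit_le hV))

theorem card_not_mem [Finite U] (I : Set U) : Nat.card {a // a ∉ I} + I.ncard = Nat.card U := by
  rw [← Set.ncard_compl_add_ncard I, ← Nat.card_coe_set_eq]
  rfl

theorem card_not_mem_singleton [Finite U] (i : U) :
    Nat.card {a // a ∉ ({i} : Set U)} = Nat.card U - 1 := by
  have := card_not_mem ({i} : Set U)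
  rw [Set.ncard_singleton] at this
  omega

/-- With a single identity element i, axiom (I) forces every (a, i, a) into `T`, so no freedom is
left outside the restriction. -/
theorem restrictRel_injOn_of_singleton (f : U → U) (i : U) :
    Set.InjOn (restrictRel {i}) {T | AxP ⟨f, T, {i}⟩ ∧ AxI ⟨f, T, {i}⟩} := by
  rintro T ⟨hP, hI⟩ T' ⟨hP', hI'⟩ h
  refine T_eq_of_restrict_eq hP hI hP' hI' ?_ ?_
  · intro a b c ha hb hc
    have := Set.ext_iff.1 h (⟨a, ha⟩, ⟨b, hb⟩, ⟨c, hc⟩)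
    exact this
  · intro a j _ hj
    obtain ⟨k, hki, hk⟩ := (hI a a).1 rfl
    obtain ⟨l, hli, hl⟩ := (hI' a a).1 rfl
    rw [Set.mem_singleton_iff.1 hki] at hk
    rw [Set.mem_singleton_iff.1 hli] at hl
    rw [Set.mem_singleton_iff.1 hj]
    exact iff_of_true hk hl

/-- The number of integral members of `FAS` with a given involution. -/
theorem ncard_T_singleton_sq_mul_le [Finite U] (f : U → U) (i : U) :
    {T : Set (U × U × U) | AxP ⟨f, T, {i}⟩ ∧ AxI ⟨f, T, {i}⟩}.ncard ^ 2 *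
      2 ^ ((Nat.card U - 1) * Nat.card {a // f a ≠ a}) ≤
      (2 ^ (Nat.card U + 1).choose 3) ^ 2 := by
  rcases Set.eq_empty_or_nonempty
    {T : Set (U × U × U) | AxP ⟨f, T, {i}⟩ ∧ AxI ⟨f, T, {i}⟩} with h0 | ⟨T₀, hP₀, hI₀⟩
  · rw [h0]; simp
  have hf : Function.Involutive f := hP₀.involutive hI₀
  have hfI : ∀ a, a ∉ ({i} : Set U) → f a ∉ ({i} : Set U) := hP₀.f_not_mem hI₀
  have hfi : f i = i := hP₀.f_eq_of_mem hI₀ rfl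
  have hV := involutive_subtypeMap hf hfI
  have h1 : {T : Set (U × U × U) | AxP ⟨f, T, {i}⟩ ∧ AxI ⟨f, T, {i}⟩}.ncard ≤
      2 ^ Nat.card (TripleOrbit hV) := by
    rw [← ncard_axP hV]
    exact Set.ncard_le_ncard_of_injOn (restrictRel {i}) (fun T hT => hT.1.restrictRel hfI)
      (restrictRel_injOn_of_singleton f i) (Set.toFinite _)
  have h2 := two_mul_card_tripleOrbit hV
  have h3 : Nat.card {x // Subtype.map f hfI x ≠ x} = Nat.card {a // f a ≠ a} :=
    Nat.card_congr
      { toFun := fun x => ⟨x.1.1, fun h => x.2 (Subtype.ext h)⟩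
        invFun := fun a => ⟨⟨a.1, fun h => a.2 (by rw [Set.mem_singleton_iff.1 h, hfi])⟩,
          fun h => a.2 (congrArg Subtype.val h)⟩
        left_inv := fun _ => rfl
        right_inv := fun _ => rfl }
  have : Nonempty U := ⟨i⟩
  have hpos : 0 < Nat.card U := Nat.card_pos
  rw [h3, card_not_mem_singleton, show Nat.card U - 1 + 2 = Nat.card U + 1 by omega] at h2
  -- The saving is half of (n - 1) times the number of moved points, hence the squares.
  calc _ ≤ (2 ^ Nat.card (TripleOrbit hV)) ^ 2 *
        2 ^ ((Nat.card U - 1) * Nat.card {a // f a ≠ a}) :=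
        Nat.mul_le_mul_right _ (Nat.pow_le_pow_left h1 2)
    _ = (2 ^ (Nat.card U + 1).choose 3) ^ 2 := by
        rw [← pow_mul, ← pow_mul, ← pow_add, mul_comm _ 2, h2, mul_comm]

/-- The number of integral members of `FAS` with a given involution and a given nontrivial
automorphism. -/
theorem exists_ncard_T_singleton_mul_le [Finite U] (f : U → U) (i : U) (σ : Equiv.Perm U)
    (hne : σ ≠ 1) :
    ∃ w, (Nat.card U - 3) * (Nat.card U - 4) ≤ 18 * w ∧
      {T : Set (U × U × U) | (AxP ⟨f, T, {i}⟩ ∧ AxI ⟨f, T, {i}⟩) ∧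
        IsIso (⟨f, T, {i}⟩ : Str U) ⟨f, T, {i}⟩ σ}.ncard * 2 ^ w ≤
      2 ^ (Nat.card U + 1).choose 3 := by
  rcases Set.eq_empty_or_nonempty {T : Set (U × U × U) | (AxP ⟨f, T, {i}⟩ ∧ AxI ⟨f, T, {i}⟩) ∧
        IsIso (⟨f, T, {i}⟩ : Str U) ⟨f, T, {i}⟩ σ} with h0 | ⟨T₀, ⟨hP₀, hI₀⟩, hσf, hσT, hσI⟩
  · rw [h0]
    -- With nothing to count, any sufficiently large `w` serves.
    exact ⟨(Nat.card U - 3) * (Nat.card U - 4), by omega, by simp⟩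
  have hf : Function.Involutive f := hP₀.involutive hI₀
  have hfI : ∀ a, a ∉ ({i} : Set U) → f a ∉ ({i} : Set U) := hP₀.f_not_mem hI₀
  have hV := involutive_subtypeMap hf hfI
  have hσI' : ∀ a, a ∉ ({i} : Set U) ↔ σ a ∉ ({i} : Set U) := fun a => not_congr (hσI a)
  let ρ : Equiv.Perm {a // a ∉ ({i} : Set U)} := σ.subtypeEquiv hσI'
  have hρf : ∀ a, ρ (Subtype.map f hfI a) = Subtype.map f hfI (ρ a) :=
    fun a => Subtype.ext (hσf a.1)
  have hρ : ρ ≠ 1 := by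
    -- σ fixes i, so it would be trivial if it were trivial off i.
    intro h
    refine hne (Equiv.ext fun a => ?_)
    by_cases ha : a ∈ ({i} : Set U)
    · have h1 : σ a = i := (hσI a).1 ha
      have h2 : a = i := ha
      rw [h1, h2]; rfl
    · exact congrArg Subtype.val (Equiv.congr_fun h ⟨a, ha⟩)
  have : Nonempty U := ⟨i⟩
  have hpos : 0 < Nat.card U := Nat.card_pos
  obtain ⟨w, hw, hle⟩ := exists_ncard_axP_invariant_mul_le hV hρf hρ
  have hcard := card_tripleOrbit_le hV
  rw [card_not_mem_singleton] at hw hcard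
  rw [show Nat.card U - 1 + 2 = Nat.card U + 1 by omega] at hcard
  refine ⟨w, by simpa only [Nat.sub_sub] using hw, ?_⟩
  refine le_trans (Nat.mul_le_mul_right _ ?_)
    (hle.trans (Nat.pow_le_pow_right two_pos hcard))
  refine Set.ncard_le_ncard_of_injOn (restrictRel {i}) ?_
    ((restrictRel_injOn_of_singleton f i).mono fun T hT => hT.1) (Set.toFinite _)
  rintro T ⟨⟨hP, hI⟩, -, h, -⟩
  exact ⟨hP.restrictRel hfI, fun a b c => h a.1 b.1 c.1⟩

/-- The symmetric integral structure with a given identity element and given triples of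
non-identity elements. -/
def integralStr (i : U) (P : Set ({a // a ∉ ({i} : Set U)} × {a // a ∉ ({i} : Set U)} ×
    {a // a ∉ ({i} : Set U)})) : Str U where
  f := id
  T := {p | (∃ q ∈ P, p = (q.1.1, q.2.1.1, q.2.2.1)) ∨ (p.1 = i ∧ p.2.1 = p.2.2) ∨
    (p.2.1 = i ∧ p.1 = p.2.2) ∨ (p.2.2 = i ∧ p.1 = p.2.1)}
  I := {i}

theorem integralStr_mem (i : U) {P : Set ({a // a ∉ ({i} : Set U)} ×
    {a // a ∉ ({i} : Set U)} × {a // a ∉ ({i} : Set U)})} (hP : AxP ⟨id, P, ∅⟩) :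
    (AxP (integralStr i P) ∧ AxI (integralStr i P)) ∧ IsSymmetric (integralStr i P) ∧
      IsIntegral (integralStr i P) := by
  refine ⟨⟨?_, ?_⟩, fun _ => rfl, Set.ncard_singleton i⟩
  · rintro a b c (⟨⟨a', b', c'⟩, hq, he⟩ | ⟨h1, h2⟩ | ⟨h1, h2⟩ | ⟨h1, h2⟩)
    · simp only [Prod.mk.injEq] at he
      obtain ⟨rfl, rfl, rfl⟩ := he
      exact ⟨Or.inl ⟨_, (hP _ _ _ hq).1, rfl⟩, Or.inl ⟨_, (hP _ _ _ hq).2, rfl⟩⟩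
    · exact ⟨Or.inr (Or.inl ⟨h1, h2.symm⟩), Or.inr (Or.inr (Or.inr ⟨h1, h2.symm⟩))⟩
    · exact ⟨Or.inr (Or.inr (Or.inr ⟨h1, h2⟩)), Or.inr (Or.inr (Or.inl ⟨h1, h2.symm⟩))⟩
    · exact ⟨Or.inr (Or.inr (Or.inl ⟨h1, h2⟩)), Or.inr (Or.inl ⟨h1, h2.symm⟩)⟩
  · intro a b
    constructor
    · rintro rfl
      exact ⟨i, rfl, Or.inr (Or.inr (Or.inl ⟨rfl, rfl⟩))⟩
    · rintro ⟨j, hj, h⟩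
      rw [show j = i from hj] at h
      rcases h with ⟨⟨a', b', c'⟩, hq, he⟩ | ⟨h1, h2⟩ | ⟨h1, h2⟩ | ⟨h1, h2⟩
      · simp only [Prod.mk.injEq] at he
        exact absurd he.2.1.symm b'.2
      · exact h1.trans h2
      · exact h2
      · exact h2.trans h1.symm

theorem restrictRel_integralStr (i : U) (P : Set ({a // a ∉ ({i} : Set U)} ×
    {a // a ∉ ({i} : Set U)} × {a // a ∉ ({i} : Set U)})) :
    restrictRel {i} (integralStr i P).T = P := by
  ext ⟨a, b, c⟩
  rw [mem_restrictRel]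
  constructor
  · rintro (⟨⟨a', b', c'⟩, hq, he⟩ | ⟨h1, h2⟩ | ⟨h1, h2⟩ | ⟨h1, h2⟩)
    · simp only [Prod.mk.injEq] at he
      obtain ⟨h1, h2, h3⟩ := he
      rw [Subtype.ext h1, Subtype.ext h2, Subtype.ext h3]
      exact hq
    · exact absurd h1 a.2
    · exact absurd h1 b.2
    · exact absurd h1 c.2
  · intro h
    exact Or.inl ⟨_, h, rfl⟩

end Structure

instance finite_str {U : Type*} [Finite U] : Finite (Str U) :=
  Finite.of_injective (fun S : Str U => (S.f, S.T, S.I)) fun S S' h => by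
    simp only [Prod.mk.injEq] at h
    exact Str.ext h.1 h.2.1 h.2.2

/-- One fixed identity element suffices: every union of orbits off it, with f = id, extends to a
member of `FSIAS`. -/
theorem le_ncard_FSIAS {U : Type} [Finite U] [Nonempty U] :
    2 ^ (Nat.card U + 1).choose 3 ≤ {S : Str U | FSIAS U S}.ncard := by
  obtain ⟨i⟩ := ‹Nonempty U›
  have hid : Function.Involutive (id : {a // a ∉ ({i} : Set U)} → {a // a ∉ ({i} : Set U)}) :=
    fun _ => rfl
  have : Nonempty U := ⟨i⟩
  have hpos : 0 < Nat.card U := Nat.card_pos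
  have h2 := two_mul_card_tripleOrbit hid
  have h3 : Nat.card {x : {a // a ∉ ({i} : Set U)} // id x ≠ x} = 0 := by simp
  rw [h3, card_not_mem_singleton, show Nat.card U - 1 + 2 = Nat.card U + 1 by omega] at h2
  have h4 : Nat.card (TripleOrbit hid) = (Nat.card U + 1).choose 3 := by omega
  rw [← h4, ← ncard_axP hid]
  refine Set.ncard_le_ncard_of_injOn (integralStr i) ?_ ?_ (Set.toFinite _)
  · intro P hP
    obtain ⟨h, h'⟩ := integralStr_mem i hP
    exact ⟨⟨inferInstance, h⟩, h'⟩
  · intro P _ P' _ h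
    rw [← restrictRel_integralStr i P, h, restrictRel_integralStr]

/-! ### Counting isomorphism types by automorphisms -/

section Unlabelled

variable {U : Type*}

/-- Transport of structures along permutations of the universe. -/
instance strAction : MulAction (Equiv.Perm U) (Str U) where
  smul σ S := ⟨fun a => σ (S.f (σ.symm a)),
    {p | (σ.symm p.1, σ.symm p.2.1, σ.symm p.2.2) ∈ S.T}, {a | σ.symm a ∈ S.I}⟩
  one_smul _ := rfl
  mul_smul _ _ _ := rfl

theorem isIso_iff_smul_eq {S S' : Str U} {σ : Equiv.Perm U} : IsIso S S' σ ↔ σ • S = S' := by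
  constructor
  · rintro ⟨h1, h2, h3⟩
    refine Str.ext (funext fun a => ?_) (Set.ext fun ⟨a, b, c⟩ => ?_) (Set.ext fun a => ?_)
    · change σ (S.f (σ.symm a)) = S'.f a
      rw [h1, Equiv.apply_symm_apply]
    · change (σ.symm a, σ.symm b, σ.symm c) ∈ S.T ↔ _
      rw [h2]
      simp
    · change σ.symm a ∈ S.I ↔ _
      rw [h3]
      simp
  · rintro rfl
    refine ⟨fun a => ?_, fun a b c => ?_, fun a => ?_⟩
    · change _ = σ (S.f (σ.symm (σ a)))
      rw [Equiv.symm_apply_apply]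
    · change _ ↔ (σ.symm (σ a), σ.symm (σ b), σ.symm (σ c)) ∈ S.T
      simp
    · change _ ↔ σ.symm (σ a) ∈ S.I
      simp

theorem ncard_isomorphic_mul_ncard_automorphisms (S : Str U) :
    {S' : Str U | Isomorphic S S'}.ncard * {σ : Equiv.Perm U | IsIso S S σ}.ncard =
      Nat.card (Equiv.Perm U) := by
  have h1 : {S' : Str U | Isomorphic S S'} = MulAction.orbit (Equiv.Perm U) S := by
    ext S'
    exact exists_congr fun σ => isIso_iff_smul_eq
  have h2 : {σ : Equiv.Perm U | IsIso S S σ} =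
      (MulAction.stabilizer (Equiv.Perm U) S : Set (Equiv.Perm U)) := by
    ext σ
    exact isIso_iff_smul_eq
  rw [h1, h2, ← Nat.card_coe_set_eq, ← Nat.card_coe_set_eq, ← Nat.card_prod]
  exact Nat.card_congr (MulAction.orbitProdStabilizerEquivGroup (Equiv.Perm U) S)

theorem ncard_eq_sum_fiber {ι α : Type*} [Fintype ι] [Finite α] (X : Set (ι × α)) :
    X.ncard = ∑ i, {a | (i, a) ∈ X}.ncard := by
  rw [← Nat.card_coe_set_eq]
  have e : X ≃ Σ i, {a | (i, a) ∈ X} :=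
    { toFun := fun p => ⟨p.1.1, p.1.2, p.2⟩
      invFun := fun p => ⟨(p.1, p.2.1), p.2.2⟩
      left_inv := fun _ => rfl
      right_inv := fun _ => rfl }
  rw [Nat.card_congr e, Nat.card_sigma]
  simp [Nat.card_coe_set_eq]

/-- The number of isomorphism types of a class of structures on a fixed universe is given by
the number of automorphisms of its members. -/
theorem ncard_image_mk_mul_card_perm [Finite U] (L : Set (Str U))
    (hL : ∀ S S', Isomorphic S S' → S ∈ L → S' ∈ L) :
    (Quotient.mk (isoSetoid U) '' L).ncard * Nat.card (Equiv.Perm U) =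
      {p : Str U × Equiv.Perm U | p.1 ∈ L ∧ IsIso p.1 p.1 p.2}.ncard := by
  classical
  have := Fintype.ofFinite (Str U)
  let c : Str U → ℕ := fun S => {σ : Equiv.Perm U | IsIso S S σ}.ncard
  have hsum : {p : Str U × Equiv.Perm U | p.1 ∈ L ∧ IsIso p.1 p.1 p.2}.ncard =
      ∑ S ∈ L.toFinset, c S := by
    rw [ncard_eq_sum_fiber, ← Set.filter_mem_univ_eq_toFinset, Finset.sum_filter]
    refine Finset.sum_congr rfl fun S _ => ?_
    by_cases hS : S ∈ L <;> simp [hS, c]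
  -- The fibres are the isomorphism classes. Isomorphic structures have equally many automorphisms,
  -- so by orbit-stabilizer each fibre contributes n!.
  rw [hsum, ← Finset.sum_fiberwise_of_maps_to (g := Quotient.mk (isoSetoid U))
    (t := L.toFinset.image (Quotient.mk (isoSetoid U)))
    (fun S hS => Finset.mem_image_of_mem _ hS)]
  have him : Quotient.mk (isoSetoid U) '' L =
      ↑(L.toFinset.image (Quotient.mk (isoSetoid U))) := by simp
  rw [him, Set.ncard_coe_finset, ← smul_eq_mul]
  refine (Finset.sum_eq_card_nsmul fun q hq => ?_).symm
  obtain ⟨S₀, hS₀, rfl⟩ := Finset.mem_image.1 hq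
  rw [Set.mem_toFinset] at hS₀
  have hfib : ∀ S, S ∈ L.toFinset.filter
      (fun S => Quotient.mk (isoSetoid U) S = Quotient.mk (isoSetoid U) S₀) ↔
      Isomorphic S₀ S := by
    intro S
    rw [Finset.mem_filter, Set.mem_toFinset]
    constructor
    · rintro ⟨_, h⟩
      exact (isoSetoid U).symm (Quotient.exact h)
    · intro h
      exact ⟨hL _ _ h hS₀, Quotient.sound ((isoSetoid U).symm h)⟩
  have hcard : (L.toFinset.filter
      (fun S => Quotient.mk (isoSetoid U) S = Quotient.mk (isoSetoid U) S₀)).card =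
      {S : Str U | Isomorphic S₀ S}.ncard := by
    rw [← Set.ncard_coe_finset]
    congr 1
    ext S
    exact hfib S
  have hpos : 0 < {S : Str U | Isomorphic S₀ S}.ncard :=
    (Set.ncard_pos (Set.toFinite _)).2 ⟨S₀, (isoSetoid U).refl S₀⟩
  rw [Finset.sum_eq_card_nsmul (b := c S₀), hcard, smul_eq_mul]
  · exact ncard_isomorphic_mul_ncard_automorphisms S₀
  · intro S hS
    have hiso := (hfib S).1 hS
    have hset : {S' : Str U | Isomorphic S S'} = {S' : Str U | Isomorphic S₀ S'} := by
      ext S'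
      exact ⟨(isoSetoid U).trans hiso, (isoSetoid U).trans ((isoSetoid U).symm hiso)⟩
    have h1 := ncard_isomorphic_mul_ncard_automorphisms S
    rw [hset, ← ncard_isomorphic_mul_ncard_automorphisms S₀] at h1
    exact Nat.eq_of_mul_eq_mul_left hpos h1

end Unlabelled

/-! ### Reduction of both probabilities to exceptional pairs -/

/-- The pairs of a member of `K` and one of its automorphisms, except for the pairs of a member
with the property `P` and its trivial automorphism. -/
def exceptionalPairs (K P : StrClass) (U : Type) : Set (Str U × Equiv.Perm U) :=
  {p | K U p.1 ∧ IsIso p.1 p.1 p.2 ∧ ¬ (P U p.1 ∧ p.2 = 1)}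

section Ratio

variable {K P : StrClass} {n : ℕ}

theorem isIso_one {U : Type*} (S : Str U) : IsIso S S (1 : Equiv.Perm U) :=
  ⟨fun _ => rfl, fun _ _ _ => Iff.rfl, fun _ => Iff.rfl⟩

/-- A member without `P`, paired with the identity permutation, is exceptional. -/
theorem ncard_labelled_le_add :
    (labelled K n).ncard ≤
      (labelled (sat K P) n).ncard + (exceptionalPairs K P (Fin n)).ncard := by
  have hsub : labelled K n ⊆ labelled (sat K P) n ∪ Prod.fst '' exceptionalPairs K P (Fin n) := by
    intro S hS
    by_cases hP : P (Fin n) S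
    · exact Or.inl ⟨hS, hP⟩
    · exact Or.inr ⟨(S, 1), ⟨hS, isIso_one S, fun h => hP h.1⟩, rfl⟩
  exact (Set.ncard_le_ncard hsub (Set.toFinite _)).trans ((Set.ncard_union_le _ _).trans
    (Nat.add_le_add_left (Set.ncard_image_le (Set.toFinite _)) _))

theorem ncard_unlabelled_mul_le_add
    (hK : ∀ S S' : Str (Fin n), Isomorphic S S' → K (Fin n) S → K (Fin n) S')
    (hP : ∀ S S' : Str (Fin n), Isomorphic S S' → P (Fin n) S → P (Fin n) S') :
    (unlabelled K n).ncard * Nat.card (Equiv.Perm (Fin n)) ≤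
      (unlabelled (sat K P) n).ncard * Nat.card (Equiv.Perm (Fin n)) +
        (exceptionalPairs K P (Fin n)).ncard := by
  have h1 : (unlabelled K n).ncard * Nat.card (Equiv.Perm (Fin n)) = _ :=
    ncard_image_mk_mul_card_perm (labelled K n) hK
  have h2 : (unlabelled (sat K P) n).ncard * Nat.card (Equiv.Perm (Fin n)) = _ :=
    ncard_image_mk_mul_card_perm (labelled (sat K P) n)
      fun S S' h hS => ⟨hK S S' h hS.1, hP S S' h hS.2⟩
  rw [h1, h2]
  refine (Set.ncard_le_ncard ?_ (Set.toFinite _)).trans (Set.ncard_union_le _ _)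
  rintro ⟨S, σ⟩ ⟨hS, hσ⟩
  by_cases h : P (Fin n) S ∧ σ = 1
  · exact Or.inl ⟨⟨hS, h.1⟩, hσ⟩
  · exact Or.inr ⟨hS, hσ, h⟩

theorem ncard_labelled_le_unlabelled_mul
    (hK : ∀ S S' : Str (Fin n), Isomorphic S S' → K (Fin n) S → K (Fin n) S') :
    (labelled K n).ncard ≤ (unlabelled K n).ncard * Nat.card (Equiv.Perm (Fin n)) := by
  have h1 : (unlabelled K n).ncard * Nat.card (Equiv.Perm (Fin n)) = _ :=
    ncard_image_mk_mul_card_perm (labelled K n) hK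
  rw [h1]
  exact Set.ncard_le_ncard_of_injOn (fun S => (S, 1)) (fun S hS => ⟨hS, isIso_one S⟩)
    (fun S _ S' _ h => congrArg Prod.fst h) (Set.toFinite _)

theorem labelled_sat_subset : labelled (sat K P) n ⊆ labelled K n := fun _ h => h.1

/-- The separate lower bound `d` lets the labelled count of `sat K P` be the denominator of the
error in the unlabelled case too. -/
theorem ratio_bounds {a b e d : ℕ} (hab : a ≤ b) (hb : b ≤ a + e) (hd : 0 < d) (hda : d ≤ a) :
    1 - (e : ℝ) / d ≤ (a : ℝ) / b ∧ (a : ℝ) / b ≤ 1 := by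
  have hd' : (0 : ℝ) < d := Nat.cast_pos.2 hd
  have hb' : (d : ℝ) ≤ b := Nat.cast_le.2 (hda.trans hab)
  have hab' : (a : ℝ) ≤ b := Nat.cast_le.2 hab
  have hbe : (b : ℝ) ≤ a + e := by exact_mod_cast hb
  have hbp : (0 : ℝ) < b := hd'.trans_le hb'
  refine ⟨?_, div_le_one_of_le₀ hab' hbp.le⟩
  have h1 : (e : ℝ) / b ≤ e / d := div_le_div_of_nonneg_left (Nat.cast_nonneg _) hd' hb'
  have h2 : 1 - (e : ℝ) / b ≤ a / b := by
    rw [sub_le_iff_le_add, ← add_div, one_le_div hbp]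
    exact hbe
  linarith

theorem labelled_ratio_bounds (hpos : 0 < (labelled (sat K P) n).ncard) :
    1 - ((exceptionalPairs K P (Fin n)).ncard : ℝ) / (labelled (sat K P) n).ncard ≤
      ((labelled (sat K P) n).ncard : ℝ) / (labelled K n).ncard ∧
    ((labelled (sat K P) n).ncard : ℝ) / (labelled K n).ncard ≤ 1 :=
  ratio_bounds (Set.ncard_le_ncard labelled_sat_subset (Set.toFinite _)) ncard_labelled_le_add
    hpos le_rfl

theorem unlabelled_ratio_bounds
    (hK : ∀ S S' : Str (Fin n), Isomorphic S S' → K (Fin n) S → K (Fin n) S')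
    (hP : ∀ S S' : Str (Fin n), Isomorphic S S' → P (Fin n) S → P (Fin n) S')
    (hpos : 0 < (labelled (sat K P) n).ncard) :
    1 - ((exceptionalPairs K P (Fin n)).ncard : ℝ) / (labelled (sat K P) n).ncard ≤
      ((unlabelled (sat K P) n).ncard : ℝ) / (unlabelled K n).ncard ∧
    ((unlabelled (sat K P) n).ncard : ℝ) / (unlabelled K n).ncard ≤ 1 := by
  have hfac : ((Nat.card (Equiv.Perm (Fin n)) : ℕ) : ℝ) ≠ 0 := Nat.cast_ne_zero.2 Nat.card_pos.ne'
  rw [← mul_div_mul_right ((unlabelled (sat K P) n).ncard : ℝ) _ hfac, ← Nat.cast_mul,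
    ← Nat.cast_mul]
  refine ratio_bounds (Nat.mul_le_mul_right _ (Set.ncard_le_ncard
    (Set.image_mono labelled_sat_subset) (Set.toFinite _)))
    (ncard_unlabelled_mul_le_add hK hP) hpos (ncard_labelled_le_unlabelled_mul ?_)
  exact fun S S' h hS => ⟨hK S S' h hS.1, hP S S' h hS.2⟩

end Ratio

theorem tendsto_sizes {K : StrClass} (hK : ∀ n, 0 < n → (labelled K n).Nonempty) :
    Tendsto (sizes K) atTop atTop := by
  refine (Nat.nth_strictMono ?_).tendsto_atTop
  refine (Set.Ioi_infinite 0).mono fun n hn => ⟨hn, (hK n hn).image _⟩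

/-- If the members of `K` without the property `P` and the nontrivial automorphisms of members
of `K` are rare, then `P` has labelled and unlabelled probability one in `K`. -/
theorem almostAll_of_tendsto {K P : StrClass}
    (hK : ∀ n, ∀ S S' : Str (Fin n), Isomorphic S S' → K (Fin n) S → K (Fin n) S')
    (hP : ∀ n, ∀ S S' : Str (Fin n), Isomorphic S S' → P (Fin n) S → P (Fin n) S')
    (hpos : ∀ n, 0 < n → 0 < (labelled (sat K P) n).ncard)
    (hlim : Tendsto (fun n => ((exceptionalPairs K P (Fin n)).ncard : ℝ) /
      (labelled (sat K P) n).ncard) atTop (𝓝 0)) :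
    AlmostAll K P ∧ HasLabelledProb K P 1 := by
  have hs : Tendsto (sizes K) atTop atTop := tendsto_sizes fun n hn =>
    (Set.nonempty_of_ncard_ne_zero (hpos n hn).ne').mono labelled_sat_subset
  have hlow : Tendsto (fun n => 1 - ((exceptionalPairs K P (Fin n)).ncard : ℝ) /
      (labelled (sat K P) n).ncard) atTop (𝓝 1) := by
    simpa using hlim.const_sub 1
  constructor
  · have h : Tendsto (fun n => ((unlabelled (sat K P) n).ncard : ℝ) / (unlabelled K n).ncard)
        atTop (𝓝 1) := by
      refine tendsto_of_tendsto_of_tendsto_of_le_of_le' hlow tendsto_const_nhds ?_ ?_ <;>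
        filter_upwards [eventually_gt_atTop 0] with n hn
      · exact (unlabelled_ratio_bounds (hK n) (hP n) (hpos n hn)).1
      · exact (unlabelled_ratio_bounds (hK n) (hP n) (hpos n hn)).2
    exact h.comp hs
  · have h : Tendsto (fun n => ((labelled (sat K P) n).ncard : ℝ) / (labelled K n).ncard)
        atTop (𝓝 1) := by
      refine tendsto_of_tendsto_of_tendsto_of_le_of_le' hlow tendsto_const_nhds ?_ ?_ <;>
        filter_upwards [eventually_gt_atTop 0] with n hn
      · exact (labelled_ratio_bounds (hpos n hn)).1
      · exact (labelled_ratio_bounds (hpos n hn)).2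
    exact h.comp hs

/-! ### Upper bounds for the three kinds of exceptional pairs -/

section Bounds

/-- The sum over all maps factors over points: each point stays, with weight 1, or goes to one of
the other points, with weight y. -/
theorem sum_moved_pow (α : Type*) [Fintype α] [DecidableEq α] (y : ℝ) :
    ∑ f : α → α, y ^ Nat.card {a // f a ≠ a} = (1 + (Fintype.card α - 1) * y) ^ Fintype.card α := by
  have h1 : ∀ f : α → α, y ^ Nat.card {a // f a ≠ a} = ∏ a, if f a = a then 1 else y := by
    intro f
    rw [Finset.prod_ite, Finset.prod_const_one, one_mul, Finset.prod_const,
      Nat.card_eq_fintype_card, Fintype.card_subtype]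
  have h2 : ∀ a : α, ∑ b : α, (if b = a then (1 : ℝ) else y) = 1 + (Fintype.card α - 1) * y := by
    intro a
    rw [← Finset.add_sum_erase _ _ (Finset.mem_univ a), if_pos rfl,
      Finset.sum_congr rfl (g := fun _ => y) fun b hb => if_neg (Finset.ne_of_mem_erase hb),
      Finset.sum_const, Finset.card_erase_of_mem (Finset.mem_univ a), nsmul_eq_mul,
      Finset.card_univ, Nat.cast_sub (Fintype.card_pos_iff.2 ⟨a⟩), Nat.cast_one]
  simp only [h1]
  rw [← Fintype.prod_sum (fun a b => if b = a then (1 : ℝ) else y)]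
  simp [h2]

/-- Integral, non-symmetric members of `FAS`. -/
theorem ncard_nonsymmetric_le {U : Type*} [Fintype U] [DecidableEq U] {y : ℝ} (hy : 0 ≤ y)
    (hy2 : y ^ 2 * 2 ^ (Nat.card U - 1) = 1) :
    ({p : (U × (U → U)) × Set (U × U × U) | p.1.2 ≠ id ∧
      AxP ⟨p.1.2, p.2, {p.1.1}⟩ ∧ AxI ⟨p.1.2, p.2, {p.1.1}⟩}.ncard : ℝ) ≤
    Nat.card U * ((2 ^ (Nat.card U + 1).choose 3) *
      ((1 + (Nat.card U - 1) * y) ^ Nat.card U - 1)) := by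
  set Q : ℝ := 2 ^ (Nat.card U + 1).choose 3 with hQ
  have hterm : ∀ (i : U) (f : U → U),
      ({T : Set (U × U × U) | AxP ⟨f, T, {i}⟩ ∧ AxI ⟨f, T, {i}⟩}.ncard : ℝ) ≤
        Q * y ^ Nat.card {a // f a ≠ a} := by
    intro i f
    have h := ncard_T_singleton_sq_mul_le f i
    set c := {T : Set (U × U × U) | AxP ⟨f, T, {i}⟩ ∧ AxI ⟨f, T, {i}⟩}.ncard
    set d := Nat.card {a // f a ≠ a}
    have h' : (c : ℝ) ^ 2 * 2 ^ ((Nat.card U - 1) * d) ≤ Q ^ 2 := by rw [hQ]; exact_mod_cast h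
    refine (pow_le_pow_iff_left₀ (Nat.cast_nonneg _) (by positivity) two_ne_zero).1 ?_
    have h3 : (y ^ d) ^ 2 * 2 ^ ((Nat.card U - 1) * d) = 1 := by
      rw [← pow_mul, mul_comm d 2, pow_mul, pow_mul, ← mul_pow, hy2, one_pow]
    calc (c : ℝ) ^ 2 = (c : ℝ) ^ 2 * 2 ^ ((Nat.card U - 1) * d) * (y ^ d) ^ 2 := by
          rw [mul_assoc, mul_comm (2 ^ _) ((y ^ d) ^ 2), h3, mul_one]
      _ ≤ Q ^ 2 * (y ^ d) ^ 2 := by gcongr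
      _ = _ := by ring
  rw [ncard_eq_sum_fiber, Nat.cast_sum, Fintype.sum_prod_type]
  have hinner : ∀ i : U, ∑ f : U → U, (({T : Set (U × U × U) | ((i, f), T) ∈
      {p : (U × (U → U)) × Set (U × U × U) | p.1.2 ≠ id ∧
      AxP ⟨p.1.2, p.2, {p.1.1}⟩ ∧ AxI ⟨p.1.2, p.2, {p.1.1}⟩}}.ncard : ℕ) : ℝ) ≤
      Q * ((1 + (Nat.card U - 1) * y) ^ Nat.card U - 1) := by
    intro i
    -- The term f = id equals 1; leaving it out produces the -1 in the bound.
    have hs := sum_moved_pow U y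
    rw [← Finset.add_sum_erase _ _ (Finset.mem_univ (id : U → U))] at hs
    have h0 : Nat.card {a : U // id a ≠ a} = 0 := by simp
    rw [h0, pow_zero] at hs
    rw [Nat.card_eq_fintype_card, ← hs, add_sub_cancel_left, Finset.mul_sum,
      ← Finset.add_sum_erase _ _ (Finset.mem_univ (id : U → U))]
    simp only [Set.mem_ofPred_eq, ne_eq, not_true_eq_false, false_and, Set.ofPred_false,
      Set.ncard_empty, Nat.cast_zero, zero_add]
    refine Finset.sum_le_sum fun f hf => le_trans ?_ (hterm i f)
    exact Nat.cast_le.2 (Set.ncard_le_ncard (fun T hT => hT.2) (Set.toFinite _))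
  calc _ ≤ ∑ _i : U, Q * ((1 + (Nat.card U - 1) * y) ^ Nat.card U - 1) :=
        Finset.sum_le_sum fun i _ => hinner i
    _ = _ := by rw [Finset.sum_const, nsmul_eq_mul, Finset.card_univ, Nat.card_eq_fintype_card]

/-- Here r = 2^(-1/36), so the saving 2^(-w) is r^(36w). One base r then serves both the non-rigid
and the non-integral case, with m = n². -/
theorem le_mul_pow_of_mul_two_pow_le {c C w m : ℕ} {r : ℝ} (hr : 0 ≤ r) (hr36 : r ^ 36 = 1 / 2)
    (hm : m ≤ 36 * w) (h : c * 2 ^ w ≤ 2 ^ C) : (c : ℝ) ≤ 2 ^ C * r ^ m := by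
  have h' : (c : ℝ) * 2 ^ w ≤ 2 ^ C := by exact_mod_cast h
  have hr1 : r ≤ 1 := by
    by_contra! hlt
    have := one_lt_pow₀ hlt (n := 36) (by norm_num)
    linarith
  have h2 : (2 : ℝ) ^ w * r ^ (36 * w) = 1 := by
    rw [pow_mul, hr36, ← mul_pow]; norm_num
  calc (c : ℝ) = c * 2 ^ w * r ^ (36 * w) := by rw [mul_assoc, h2, mul_one]
    _ ≤ 2 ^ C * r ^ (36 * w) := by gcongr
    _ ≤ 2 ^ C * r ^ m := by gcongr 2 ^ C * ?_; exact pow_le_pow_of_le_one hr hr1 hm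

/-- Pairs of an integral member of `FAS` and a nontrivial automorphism. -/
theorem ncard_nonrigid_le {U : Type*} [Fintype U] [DecidableEq U] {r : ℝ} (hr : 0 ≤ r)
    (hr36 : r ^ 36 = 1 / 2) (hn : 12 ≤ Nat.card U) :
    ({p : (U × (U → U) × Equiv.Perm U) × Set (U × U × U) | p.1.2.2 ≠ 1 ∧
      (AxP ⟨p.1.2.1, p.2, {p.1.1}⟩ ∧ AxI ⟨p.1.2.1, p.2, {p.1.1}⟩) ∧
      IsIso (⟨p.1.2.1, p.2, {p.1.1}⟩ : Str U) ⟨p.1.2.1, p.2, {p.1.1}⟩ p.1.2.2}.ncard : ℝ) ≤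
    (Nat.card U * (Nat.card U ^ Nat.card U * (Nat.card U).factorial) : ℕ) *
      ((2 ^ (Nat.card U + 1).choose 3) * r ^ (Nat.card U ^ 2)) := by
  rw [ncard_eq_sum_fiber, Nat.cast_sum]
  refine (Finset.sum_le_card_nsmul _ _
    ((2 ^ (Nat.card U + 1).choose 3) * r ^ (Nat.card U ^ 2)) ?_).trans_eq ?_
  · rintro ⟨i, f, σ⟩ -
    by_cases hσ : σ = 1
    · simp only [hσ, Set.mem_ofPred_eq, ne_eq, not_true_eq_false, false_and, Set.ofPred_false,
        Set.ncard_empty, Nat.cast_zero]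
      positivity
    · obtain ⟨w, hw, hle⟩ := exists_ncard_T_singleton_mul_le f i σ hσ
      -- 2(n-3)(n-4) - n² = (n-2)(n-12), which is where the threshold 12 comes from.
      have hm : Nat.card U ^ 2 ≤ 36 * w := by
        obtain ⟨m, hm⟩ := Nat.exists_eq_add_of_le hn
        rw [hm] at hw ⊢
        rw [show 12 + m - 3 = m + 9 by omega, show 12 + m - 4 = m + 8 by omega] at hw
        nlinarith
      refine le_trans (Nat.cast_le.2 ?_) (le_mul_pow_of_mul_two_pow_le hr hr36 hm hle)
      exact Set.ncard_le_ncard (fun T hT => hT.2) (Set.toFinite _)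
  · rw [nsmul_eq_mul, Finset.card_univ, Fintype.card_prod, Fintype.card_prod, Fintype.card_perm,
      Fintype.card_fun, Nat.card_eq_fintype_card]

/-- With N non-identity and k ≥ 2 identity elements, the exponent in `ncard_T_le` falls short of
C(n+1, 3), n = N + k, by at least n²/36. For k = 2 the gap is (N² - N + 2)/2. -/
theorem choose_bound {N k : ℕ} (hk : 2 ≤ k) :
    36 * ((N + 2).choose 3 + N * k) + (N + k) ^ 2 ≤ 36 * (N + k + 1).choose 3 := by
  obtain ⟨j, rfl⟩ := Nat.exists_eq_add_of_le hk
  have h1 := six_mul_choose_three N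
  have h2 := six_mul_choose_three (N + j + 1)
  rw [show N + (2 + j) + 1 = N + j + 1 + 2 by ring]
  have h3 : 6 * (N ^ 3 + 3 * N ^ 2 + 2 * N) + 36 * (N * (2 + j)) + (N + (2 + j)) ^ 2 ≤
      6 * ((N + j + 1) ^ 3 + 3 * (N + j + 1) ^ 2 + 2 * (N + j + 1)) := by
    zify
    nlinarith [sq_nonneg ((N : ℤ) - 1), sq_nonneg ((j : ℤ)), sq_nonneg ((N : ℤ) + j - 1),
      mul_nonneg (Int.natCast_nonneg N) (Int.natCast_nonneg j),
      mul_nonneg (mul_nonneg (Int.natCast_nonneg N) (Int.natCast_nonneg N))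
        (Int.natCast_nonneg j),
      mul_nonneg (mul_nonneg (Int.natCast_nonneg N) (Int.natCast_nonneg j))
        (Int.natCast_nonneg j), pow_nonneg (Int.natCast_nonneg j) 3,
      Int.natCast_nonneg N, Int.natCast_nonneg j]
  nlinarith

/-- Pairs of a non-integral member of `FAS` and a permutation. -/
theorem ncard_nonintegral_le {U : Type*} [Fintype U] [DecidableEq U] {r : ℝ} (hr : 0 ≤ r)
    (hr36 : r ^ 36 = 1 / 2) :
    ({p : (Set U × (U → U) × Equiv.Perm U) × Set (U × U × U) | 2 ≤ p.1.1.ncard ∧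
      AxP ⟨p.1.2.1, p.2, p.1.1⟩ ∧ AxI ⟨p.1.2.1, p.2, p.1.1⟩}.ncard : ℝ) ≤
    (2 ^ Nat.card U * (Nat.card U ^ Nat.card U * (Nat.card U).factorial) : ℕ) *
      ((2 ^ (Nat.card U + 1).choose 3) * r ^ (Nat.card U ^ 2)) := by
  classical
  rw [ncard_eq_sum_fiber, Nat.cast_sum]
  refine (Finset.sum_le_card_nsmul _ _
    ((2 ^ (Nat.card U + 1).choose 3) * r ^ (Nat.card U ^ 2)) ?_).trans_eq ?_
  · rintro ⟨I, f, σ⟩ -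
    by_cases hI : 2 ≤ I.ncard
    · have hle := ncard_T_le f I
      have hb := choose_bound (N := Nat.card {a // a ∉ I}) hI
      rw [card_not_mem] at hb
      obtain ⟨w, hw⟩ := Nat.exists_eq_add_of_le (show
        (Nat.card {a // a ∉ I} + 2).choose 3 + Nat.card {a // a ∉ I} * I.ncard ≤
          (Nat.card U + 1).choose 3 by omega)
      refine le_trans (Nat.cast_le.2 ?_)
        (le_mul_pow_of_mul_two_pow_le hr hr36 (w := w) (by omega)
          ((Nat.mul_le_mul_right _ hle).trans_eq (by rw [hw, pow_add _ _ w])))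
      exact Set.ncard_le_ncard (fun T hT => hT.2) (Set.toFinite _)
    · simp only [hI, Set.mem_ofPred_eq, false_and, Set.ofPred_false, Set.ncard_empty,
        Nat.cast_zero]
      positivity
  · rw [nsmul_eq_mul, Finset.card_univ, Fintype.card_prod, Fintype.card_prod, Fintype.card_perm,
      Fintype.card_fun, Fintype.card_set, Nat.card_eq_fintype_card]

/-- By (I) the set `I` is nonempty. So either it has two elements, or the structure is integral and
σ ≠ 1, or it is integral with σ = 1 and then f ≠ id. -/
theorem exceptionalPairs_FAS_subset {U : Type} [Finite U] [Nonempty U] :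
    exceptionalPairs FAS FSIAS U ⊆
      (fun p : (U × (U → U)) × Set (U × U × U) => ((⟨p.1.2, p.2, {p.1.1}⟩ : Str U), 1)) ''
        {p | p.1.2 ≠ id ∧ AxP ⟨p.1.2, p.2, {p.1.1}⟩ ∧ AxI ⟨p.1.2, p.2, {p.1.1}⟩} ∪
      ((fun p : (U × (U → U) × Equiv.Perm U) × Set (U × U × U) =>
          ((⟨p.1.2.1, p.2, {p.1.1}⟩ : Str U), p.1.2.2)) ''
        {p | p.1.2.2 ≠ 1 ∧ (AxP ⟨p.1.2.1, p.2, {p.1.1}⟩ ∧ AxI ⟨p.1.2.1, p.2, {p.1.1}⟩) ∧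
          IsIso (⟨p.1.2.1, p.2, {p.1.1}⟩ : Str U) ⟨p.1.2.1, p.2, {p.1.1}⟩ p.1.2.2} ∪
      (fun p : (Set U × (U → U) × Equiv.Perm U) × Set (U × U × U) =>
          ((⟨p.1.2.1, p.2, p.1.1⟩ : Str U), p.1.2.2)) ''
        {p | 2 ≤ p.1.1.ncard ∧ AxP ⟨p.1.2.1, p.2, p.1.1⟩ ∧ AxI ⟨p.1.2.1, p.2, p.1.1⟩}) := by
  rintro ⟨⟨f, T, I⟩, σ⟩ ⟨⟨hfin, hP, hI⟩, hσ, hnot⟩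
  by_cases h2 : 2 ≤ I.ncard
  · exact Or.inr (Or.inr ⟨((I, f, σ), T), ⟨h2, hP, hI⟩, rfl⟩)
  have hne : I.Nonempty := by
    obtain ⟨a⟩ := ‹Nonempty U›
    obtain ⟨i, hi, _⟩ := (hI a a).1 rfl
    exact ⟨i, hi⟩
  have h1 : I.ncard = 1 := by
    have := (Set.ncard_pos (Set.toFinite I)).2 hne
    omega
  obtain ⟨i, rfl⟩ := Set.ncard_eq_one.1 h1
  by_cases h : σ = 1
  · subst h
    refine Or.inl ⟨((i, f), T), ⟨?_, hP, hI⟩, rfl⟩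
    rintro rfl
    exact hnot ⟨⟨⟨hfin, hP, hI⟩, fun _ => rfl, h1⟩, rfl⟩
  · exact Or.inr (Or.inl ⟨((i, f, σ), T), ⟨h, ⟨hP, hI⟩, hσ⟩, rfl⟩)

theorem ncard_exceptionalPairs_le {U : Type} [Fintype U] [DecidableEq U] {y r : ℝ} (hy : 0 ≤ y)
    (hy2 : y ^ 2 * 2 ^ (Nat.card U - 1) = 1) (hr : 0 ≤ r) (hr36 : r ^ 36 = 1 / 2)
    (hn : 12 ≤ Nat.card U) :
    ((exceptionalPairs FAS FSIAS U).ncard : ℝ) ≤ 2 ^ (Nat.card U + 1).choose 3 *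
      (Nat.card U * ((1 + (Nat.card U - 1) * y) ^ Nat.card U - 1) +
        2 * (2 * Nat.card U ^ 2 * r ^ Nat.card U) ^ Nat.card U) := by
  have : Nonempty U := (Nat.card_pos_iff.1 (by omega)).1
  have h0 := (Set.ncard_le_ncard (exceptionalPairs_FAS_subset (U := U)) (Set.toFinite _)).trans
    ((Set.ncard_union_le _ _).trans (add_le_add (Set.ncard_image_le (Set.toFinite _))
      ((Set.ncard_union_le _ _).trans (add_le_add (Set.ncard_image_le (Set.toFinite _))
        (Set.ncard_image_le (Set.toFinite _))))))
  have h0' := (Nat.cast_le (α := ℝ)).2 h0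
  rw [Nat.cast_add, Nat.cast_add] at h0'
  have h1 := ncard_nonsymmetric_le (U := U) hy hy2
  have h2 := ncard_nonrigid_le (U := U) hr hr36 hn
  have h3 := ncard_nonintegral_le (U := U) hr hr36
  refine (h0'.trans (add_le_add h1 (add_le_add h2 h3))).trans ?_
  set m := Nat.card U
  have hfac : m.factorial ≤ m ^ m := Nat.factorial_le_pow m
  -- The choices of identity set, map and permutation together stay below (2m²)^m, which r^(m²)
  -- outweighs.
  have hX : 2 ^ m * (m ^ m * m.factorial) ≤ (2 * m ^ 2) ^ m := by
    calc _ ≤ 2 ^ m * (m ^ m * m ^ m) := by gcongr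
      _ = _ := by rw [← mul_pow, ← mul_pow]; ring
  have hX' : m * (m ^ m * m.factorial) ≤ (2 * m ^ 2) ^ m :=
    (Nat.mul_le_mul_right _ Nat.lt_two_pow_self.le).trans hX
  have hXr : ((2 ^ m * (m ^ m * m.factorial) : ℕ) : ℝ) ≤ (2 * m ^ 2) ^ m := by exact_mod_cast hX
  have hXr' : ((m * (m ^ m * m.factorial) : ℕ) : ℝ) ≤ (2 * m ^ 2) ^ m := by exact_mod_cast hX'
  have hA : (0 : ℝ) ≤ 2 ^ (m + 1).choose 3 * r ^ (m ^ 2) := by positivity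
  have hB := mul_le_mul_of_nonneg_right hXr hA
  have hB' := mul_le_mul_of_nonneg_right hXr' hA
  have hpow : (2 * (m : ℝ) ^ 2 * r ^ m) ^ m = (2 * m ^ 2) ^ m * r ^ (m ^ 2) := by
    rw [mul_pow, ← pow_mul, sq m]
  rw [hpow]
  linarith

end Bounds

/-! ### The bounds tend to zero -/

section Limits

/-- With t = √2 n² 2^(-n/2) the power is at most e^t, and e^t - 1 ≤ 2t once t ≤ 1. The whole is then
at most 2nt, which tends to 0. -/
theorem tendsto_nonsymmetric_bound :
    Tendsto (fun n : ℕ => (n : ℝ) * ((1 + (n - 1) * (√2)⁻¹ ^ (n - 1)) ^ n - 1)) atTop (𝓝 0) := by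
  have hs : |(√2)⁻¹| < 1 := by
    rw [abs_of_nonneg (by positivity)]
    exact inv_lt_one_of_one_lt₀ (Real.lt_sqrt_of_sq_lt (by norm_num))
  have h3 := tendsto_pow_const_mul_const_pow_of_abs_lt_one 3 hs
  have h2 := tendsto_pow_const_mul_const_pow_of_abs_lt_one 2 hs
  have h3' := h3.const_mul (2 * √2)
  have h2' := h2.const_mul (√2)
  rw [mul_zero] at h3' h2'
  refine squeeze_zero' ?_ ?_ h3'
  · filter_upwards [eventually_ge_atTop 1] with n hn
    have hn' : (0 : ℝ) ≤ n - 1 := by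
      rw [sub_nonneg]; exact_mod_cast hn
    have hone : (1 : ℝ) ≤ (1 + (n - 1) * (√2)⁻¹ ^ (n - 1)) ^ n :=
      one_le_pow₀ (le_add_of_nonneg_right (by positivity))
    exact mul_nonneg (Nat.cast_nonneg _) (sub_nonneg.2 hone)
  · filter_upwards [eventually_ge_atTop 1, h2'.eventually_le_const one_pos] with n hn hle
    have hn' : (0 : ℝ) ≤ n - 1 := by
      rw [sub_nonneg]; exact_mod_cast hn
    have hy : (√2)⁻¹ ^ (n - 1) = √2 * (√2)⁻¹ ^ n := by
      obtain ⟨m, rfl⟩ := Nat.exists_eq_add_of_le' hn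
      rw [Nat.add_sub_cancel, pow_succ]
      field_simp
    set t : ℝ := √2 * (n ^ 2 * (√2)⁻¹ ^ n) with ht
    have ht0 : 0 ≤ t := by positivity
    have hexp : (1 + ((n : ℝ) - 1) * (√2)⁻¹ ^ (n - 1)) ^ n ≤ Real.exp t := by
      calc _ ≤ (Real.exp ((n : ℝ) * (√2)⁻¹ ^ (n - 1))) ^ n := by
            refine pow_le_pow_left₀ (by positivity) ?_ n
            rw [add_comm]
            refine le_trans ?_ (Real.add_one_le_exp _)
            gcongr
            linarith
        _ = Real.exp t := by
            rw [← Real.exp_nat_mul, hy, ht]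
            ring_nf
    have habs := Real.abs_exp_sub_one_le (x := t) (by rwa [abs_of_nonneg ht0])
    rw [abs_of_nonneg ht0] at habs
    have h4 : (1 + ((n : ℝ) - 1) * (√2)⁻¹ ^ (n - 1)) ^ n - 1 ≤ 2 * t := by
      linarith [le_abs_self (Real.exp t - 1)]
    calc _ ≤ (n : ℝ) * (2 * t) := by gcongr
      _ = _ := by rw [ht]; ring

/-- The base tends to 0, so it is eventually at most 1/2. -/
theorem tendsto_nonrigid_bound {r : ℝ} (hr : 0 ≤ r) (hr1 : r < 1) :
    Tendsto (fun n : ℕ => (2 * (n : ℝ) ^ 2 * r ^ n) ^ n) atTop (𝓝 0) := by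
  have h := (tendsto_pow_const_mul_const_pow_of_abs_lt_one 2
    (by rwa [abs_of_nonneg hr] : |r| < 1)).const_mul 2
  rw [mul_zero] at h
  refine squeeze_zero' (Eventually.of_forall fun n => by positivity) ?_
    (tendsto_pow_atTop_nhds_zero_of_lt_one (r := (1 / 2 : ℝ)) (by norm_num) (by norm_num))
  filter_upwards [h.eventually_le_const (show (0 : ℝ) < 1 / 2 by norm_num)] with n hn
  exact pow_le_pow_left₀ (by positivity) (by rwa [mul_assoc]) n

theorem sat_FAS_FSIAS : sat FAS FSIAS = FSIAS := by
  funext U S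
  exact propext ⟨fun h => h.2, fun h => ⟨h.1, h⟩⟩

theorem le_ncard_labelled_FSIAS {n : ℕ} (hn : 0 < n) :
    2 ^ (n + 1).choose 3 ≤ (labelled (sat FAS FSIAS) n).ncard := by
  have : Nonempty (Fin n) := ⟨⟨0, hn⟩⟩
  have h := le_ncard_FSIAS (U := Fin n)
  rw [Nat.card_fin] at h
  rw [sat_FAS_FSIAS]
  exact h

theorem tendsto_exceptionalPairs :
    Tendsto (fun n => ((exceptionalPairs FAS FSIAS (Fin n)).ncard : ℝ) /
      (labelled (sat FAS FSIAS) n).ncard) atTop (𝓝 0) := by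
  obtain ⟨r, hr, hr36⟩ : ∃ r : ℝ, 0 ≤ r ∧ r ^ 36 = 1 / 2 :=
    ⟨(1 / 2) ^ ((36 : ℕ) : ℝ)⁻¹, by positivity,
      Real.rpow_inv_natCast_pow (by norm_num) (by norm_num)⟩
  have hr1 : r < 1 := by
    by_contra! hle
    have := one_le_pow₀ hle (n := 36)
    linarith
  have hlim := tendsto_nonsymmetric_bound.add ((tendsto_nonrigid_bound hr hr1).const_mul 2)
  rw [mul_zero, add_zero] at hlim
  refine squeeze_zero' (Eventually.of_forall fun n => by positivity) ?_ hlim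
  filter_upwards [eventually_ge_atTop 12] with n hn
  have hlow : ((2 : ℝ) ^ (n + 1).choose 3) ≤ (labelled (sat FAS FSIAS) n).ncard := by
    exact_mod_cast le_ncard_labelled_FSIAS (show 0 < n by omega)
  have hpos : (0 : ℝ) < 2 ^ (n + 1).choose 3 := by positivity
  have hy2 : ((√2)⁻¹ ^ (n - 1)) ^ 2 * 2 ^ (n - 1) = (1 : ℝ) := by
    rw [← pow_mul, mul_comm (n - 1) 2, pow_mul, inv_pow, Real.sq_sqrt (by norm_num), ← mul_pow]
    norm_num
  have h := ncard_exceptionalPairs_le (U := Fin n) (y := (√2)⁻¹ ^ (n - 1)) (r := r)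
    (by positivity) (by rwa [Nat.card_fin]) hr hr36 (by rwa [Nat.card_fin])
  rw [Nat.card_fin] at h
  refine (div_le_div_of_nonneg_left (Nat.cast_nonneg _) hpos hlow).trans ?_
  rw [div_le_iff₀ hpos, mul_comm]
  exact h

end Limits

/-! ### Invariance under isomorphism -/

section Isomorphism

variable {U V : Type*} {S : Str U} {S' : Str V} {σ : U ≃ V}

theorem IsIso.symm (h : IsIso S S' σ) : IsIso S' S σ.symm := by
  obtain ⟨h1, h2, h3⟩ := h
  refine ⟨fun a => ?_, fun a b c => ?_, fun a => ?_⟩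
  · rw [Equiv.symm_apply_eq, h1, Equiv.apply_symm_apply]
  · simp [h2]
  · simp [h3]

theorem IsIso.axP (h : IsIso S S' σ) (hP : AxP S) : AxP S' := by
  intro a b c hT
  have h' := h.symm
  rw [h'.2.1] at hT ⊢
  rw [h'.2.1 c, h'.1, h'.1]
  exact hP _ _ _ hT

theorem IsIso.axI (h : IsIso S S' σ) (hI : AxI S) : AxI S' := by
  intro a b
  have h' := h.symm
  rw [← σ.symm.injective.eq_iff, hI]
  constructor
  · rintro ⟨i, hi, hT⟩
    refine ⟨σ i, (h.2.2 i).1 hi, (h'.2.1 _ _ _).2 (by simpa using hT)⟩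
  · rintro ⟨i, hi, hT⟩
    exact ⟨σ.symm i, (h'.2.2 i).1 hi, (h'.2.1 _ _ _).1 hT⟩

theorem IsIso.isSymmetric (h : IsIso S S' σ) (hS : IsSymmetric S) : IsSymmetric S' := by
  intro a
  have h' := h.symm
  apply σ.symm.injective
  rw [h'.1, hS]

theorem IsIso.isIntegral (h : IsIso S S' σ) (hS : IsIntegral S) : IsIntegral S' := by
  have : S'.I = σ '' S.I := by
    ext a
    rw [h.symm.2.2, Equiv.image_eq_preimage_symm]
    rfl
  rw [IsIntegral, this, Set.ncard_image_of_injective _ σ.injective]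
  exact hS

theorem FAS_of_isomorphic {U V : Type} {S : Str U} {S' : Str V} (h : Isomorphic S S')
    (hS : FAS U S) : FAS V S' := by
  obtain ⟨σ, h⟩ := h
  have := hS.1
  exact ⟨Finite.of_equiv U σ, h.axP hS.2.1, h.axI hS.2.2⟩

theorem FSIAS_of_isomorphic {U V : Type} {S : Str U} {S' : Str V} (h : Isomorphic S S')
    (hS : FSIAS U S) : FSIAS V S' := by
  refine ⟨FAS_of_isomorphic h hS.1, ?_⟩
  obtain ⟨σ, h⟩ := h
  exact ⟨h.isSymmetric hS.2.1, h.isIntegral hS.2.2⟩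

end Isomorphism

/-! ### Atom structures -/

section Atoms

open NonassocRelAlg

variable {A : Type*} [NonassocRelAlg A]

theorem comp_mono_right (x : A) {y y' : A} (h : y ≤ y') : comp x y ≤ comp x y' := by
  refine le_of_disj fun w hw => ?_
  rw [triangle_left] at hw ⊢
  exact le_bot_iff.1 (hw ▸ inf_le_inf_left _ h)

theorem atom_le_iff {a x : A} (ha : IsAtom a) : a ≤ x ↔ x ⊓ a ≠ ⊥ := by
  rw [inf_comm, Ne, ← disjoint_iff, ha.not_disjoint_iff_le]

/-- For an atom c, c ≤ x means x ∧ c ≠ 0, so (P) is the triangle laws read on atoms. -/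
theorem axP_atomStructure : AxP (atomStructure A) := by
  rintro ⟨a, ha⟩ ⟨b, hb⟩ ⟨c, hc⟩ h
  change c ≤ comp a b at h
  change b ≤ comp (conv a) c ∧ a ≤ comp c (conv b)
  rw [atom_le_iff hc] at h
  rw [atom_le_iff hb, atom_le_iff ha]
  exact ⟨fun h' => h ((triangle_left a b c).2 h'), fun h' => h ((triangle_right a b c).2 h')⟩

theorem axI_atomStructure [Finite A] : AxI (atomStructure A) := by
  rintro ⟨a, ha⟩ ⟨b, hb⟩
  constructor
  · intro h
    obtain rfl : a = b := congrArg Subtype.val h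
    -- Since ae = a meets a, the triangle law makes this meet nonzero. Any atom below it is the
    -- required identity atom.
    have h1 : comp (conv a) a ⊓ e ≠ ⊥ := by
      rw [Ne, ← triangle_left, comp_e, inf_idem]
      exact ha.1
    obtain ⟨i, hi, hle⟩ := (IsAtomic.eq_bot_or_exists_atom_le (comp (conv a) a ⊓ e)).resolve_left h1
    refine ⟨⟨i, hi⟩, (hle.trans inf_le_right : i ≤ e), ?_⟩
    change a ≤ comp a i
    rw [atom_le_iff ha, Ne, triangle_left]
    exact (atom_le_iff hi).1 (hle.trans inf_le_left)
  · rintro ⟨⟨i, hi⟩, hie, hT⟩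
    have hie' : i ≤ e := hie
    have hT' : b ≤ comp a i := hT
    have : b ≤ a := (hT'.trans (comp_mono_right a hie')).trans_eq (comp_e a)
    exact Subtype.ext ((ha.le_iff_eq hb.1).1 this).symm

end Atoms

section ComplexAlgebra

variable {U : Type*} {S : Str U}

/-- The complex algebra of a structure in `FAS`. -/
abbrev complexAlgebra (S : Str U) (hP : AxP S) (hI : AxI S) : NonassocRelAlg (Set U) where
  __ := (inferInstance : BooleanAlgebra (Set U))
  comp X Y := {c | ∃ a ∈ X, ∃ b ∈ Y, (a, b, c) ∈ S.T}
  conv X := {a | S.f a ∈ X}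
  e := S.I
  e_comp X := by
    ext c
    constructor
    · rintro ⟨a, ha, b, hb, h⟩
      -- (P) takes (a, b, c) to (f c, a, f b), and a is an identity element, so f c = f b.
      have := hI.eq_of_mem ha (hP _ _ _ ((hP.mem_iff_right hI _ _ _).1 h)).1
      rw [hP.involutive hI |>.injective this] at *
      exact hb
    · intro hc
      obtain ⟨i, hi, h⟩ := (hI (S.f c) (S.f c)).1 rfl
      refine ⟨i, hi, c, hc, ?_⟩
      rw [hP.mem_iff_right hI, hP.mem_iff_left hI]
      exact h
  comp_e X := by
    ext c
    constructor
    · rintro ⟨a, ha, b, hb, h⟩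
      rw [← hI.eq_of_mem hb h]
      exact ha
    · intro hc
      obtain ⟨i, hi, h⟩ := (hI c c).1 rfl
      exact ⟨c, hc, i, hi, h⟩
  triangle_left X Y Z := by
    change _ = (∅ : Set U) ↔ _ = (∅ : Set U)
    rw [Set.eq_empty_iff_forall_notMem, Set.eq_empty_iff_forall_notMem]
    constructor
    · rintro h b ⟨⟨a, ha, c, hc, hT⟩, hb⟩
      exact h c ⟨⟨S.f a, ha, b, hb, (hP _ _ _ hT).1⟩, hc⟩
    · rintro h c ⟨⟨a, ha, b, hb, hT⟩, hc⟩
      refine h b ⟨⟨S.f a, ?_, c, hc, (hP _ _ _ hT).1⟩, hb⟩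
      change S.f (S.f a) ∈ X
      rwa [hP.involutive hI]
  triangle_right X Y Z := by
    change _ = (∅ : Set U) ↔ _ = (∅ : Set U)
    rw [Set.eq_empty_iff_forall_notMem, Set.eq_empty_iff_forall_notMem]
    constructor
    · rintro h a ⟨⟨c, hc, b, hb, hT⟩, ha⟩
      exact h c ⟨⟨a, ha, S.f b, hb, (hP _ _ _ hT).2⟩, hc⟩
    · rintro h c ⟨⟨a, ha, b, hb, hT⟩, hc⟩
      refine h a ⟨⟨c, hc, S.f b, ?_, (hP _ _ _ hT).2⟩, ha⟩
      change S.f (S.f b) ∈ Y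
      rwa [hP.involutive hI]

theorem isomorphic_atomStructure_complexAlgebra (hP : AxP S) (hI : AxI S) :
    Isomorphic S (@atomStructure (Set U) (complexAlgebra S hP hI)) := by
  let σ : U ≃ {X : Set U // IsAtom X} := Equiv.ofBijective
    (fun a => ⟨{a}, Set.isAtom_singleton a⟩)
    ⟨fun a b h => Set.singleton_injective (congrArg Subtype.val h), by
      rintro ⟨X, hX⟩
      obtain ⟨a, rfl⟩ := Set.isAtom_iff.1 hX
      exact ⟨a, rfl⟩⟩
  refine ⟨σ, fun a => Subtype.ext ?_, fun a b c => ?_, fun a => ?_⟩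
  · change ({S.f a} : Set U) = {x | S.f x ∈ ({a} : Set U)}
    ext x
    exact ((hP.involutive hI).eq_iff).symm
  · change _ ↔ ({c} : Set U) ⊆ {z | ∃ x ∈ ({a} : Set U), ∃ y ∈ ({b} : Set U), (x, y, z) ∈ S.T}
    simp
  · change _ ↔ ({a} : Set U) ⊆ S.I
    simp

end ComplexAlgebra

/-- Conversely, a structure in `FAS` is recovered, up to isomorphism, as the singletons of its
complex algebra. -/
theorem atomStructures_eq_FAS : AtomStructures = FAS := by
  funext U S
  refine propext ⟨?_, ?_⟩
  · rintro ⟨A, _, hA, h⟩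
    have hS : FAS _ (atomStructure A) :=
      ⟨inferInstance, axP_atomStructure, axI_atomStructure⟩
    obtain ⟨σ, hσ⟩ := h
    exact FAS_of_isomorphic ⟨σ.symm, hσ.symm⟩ hS
  · rintro ⟨hfin, hP, hI⟩
    exact ⟨Set U, complexAlgebra S hP hI, inferInstance,
      isomorphic_atomStructure_complexAlgebra hP hI⟩

theorem sat_FAS_symmetricIntegral : sat FAS SymmetricIntegral = sat FAS FSIAS :=
  sat_FAS_FSIAS.symm

theorem almostAll_FAS_FSIAS : AlmostAll FAS FSIAS ∧ HasLabelledProb FAS FSIAS 1 :=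
  almostAll_of_tendsto (fun _ _ _ => FAS_of_isomorphic) (fun _ _ _ => FSIAS_of_isomorphic)
    (fun _ hn => (Nat.two_pow_pos _).trans_le (le_ncard_labelled_FSIAS hn))
    tendsto_exceptionalPairs

end FiniteNA

theorem mainTheorem1 :
    (FiniteNA.AlmostAll FiniteNA.FAS FiniteNA.FSIAS ∧
      FiniteNA.HasLabelledProb FiniteNA.FAS FiniteNA.FSIAS 1) ∧
    (FiniteNA.AlmostAll FiniteNA.AtomStructures FiniteNA.SymmetricIntegral ∧
      FiniteNA.HasLabelledProb FiniteNA.AtomStructures FiniteNA.SymmetricIntegral 1) := by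
  refine ⟨FiniteNA.almostAll_FAS_FSIAS, ?_⟩
  have h := FiniteNA.almostAll_FAS_FSIAS
  rw [FiniteNA.atomStructures_eq_FAS]
  -- The probabilities depend on the property only through `sat`, and the two properties agree
  -- inside `FAS`.
  unfold FiniteNA.AlmostAll FiniteNA.HasLabelledProb FiniteNA.HasUnlabelledProb at h ⊢
  rw [FiniteNA.sat_FAS_symmetricIntegral]
  exact h
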